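/- Let $H\in(\tfrac13,1)$, $\sigma\in\mathbb R$, $d\in\mathbb N$, $T>0$, $x_0\in\mathbb R^d$, and let $f\in C_b^3(\mathbb R^d,\mathbb R^d)$, i.e. $f$ is $C^3$ and $f$ and its first three derivatives are bounded. Let $B^H=(B^H_t)_{t\in\mathbb R}$ be a two-sided fractional Brownian motion with Hurst parameter $H$ on a probability space: a centred Gaussian process with a.s. continuous paths and $\mathbb E(B^H_sB^H_t)=\tfrac12(|s|^{2H}+|t|^{2H}-|t-s|^{2H})$. For a path $u$ on $[0,t]$ write $|u|_{\infty;[0,t]}=\sup_{s\le t}|u_s|$ and $|u|_{C^{\alpha}([0,t])}=|u|_{\infty;[0,t]}+\sup_{r\ne s\in[0,t]}\frac{|u_s-u_r|}{|s-r|^{\alpha}}$. (i) Almost surely, for every $\varepsilon>0$ the improper Riemann–Stieltjes integrals $$y^\varepsilon_t=\frac{\sigma}{\varepsilon^{H}}\int_{-\infty}^t e^{-(t-s)/\varepsilon}\,dB^H_s,\qquad t\in\mathbb R,$$ exist (the fast stationary fractional Ornstein–Uhlenbeck process; the value of $\sigma>0$ for which $y^\varepsilon_t\sim N(0,1)$ is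 the usual normalisation), and $$\dot x^\varepsilon_t=\varepsilon^{H-1}f(x^\varepsilon_t)\,y^\varepsilon_t,\qquad x^\varepsilon_0=x_0,$$ has a unique solution on $[0,T]$. (ii) Almost surely, the rough differential equation $$dx_t=\sigma f(x_t)\,dB^H_t,\qquad x_{t=0}=x_0,$$ driven by the geometric rough path $\big(\sigma B^H,\ \tfrac12(\sigma B^H_t-\sigma B^H_s)^2\big)$ has a unique solution on $[0,T]$. If $H>\tfrac12$, then $x$ is also the unique solution of this equation understood as a Young (Riemann–Stieltjes) differential equation. (iii) Let $0<\gamma'<\gamma<H$ and $1\le p<\infty$. Then $x$ has a.s. finite $C^{\gamma'}([0,T])$ norm, $|x^\varepsilon-x|_{C^{\gamma'}([0,t])}\in L^p$ for all $\varepsilon>0$ and $t\in[0,T]$, and $x^\varepsilon$ converges to $x$ in $L^p$ in $C^{\gamma'}([0,T],\mathbb R^d)$: $$\lim_{\varepsilon\downarrow0}\Big\|\,|x^\varepsilon-x|_{C^{\gamma'}([0,T])}\Big\|_{L^p}=0 .$$ Furthermore, there is a constant $C$, not depending on $t$ and $\varepsilon$, such that for all $t\in[0,T]$ and $\varepsilon\in(0,1]$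 $$\Big\|\,|x^\varepsilon-x|_{C^{\gamma'}([0,t])}\Big\|_{L^p}\le C\,t^{\gamma-\gamma'}\varepsilon^{H-\gamma},\qquad \Big\|\,|x^\varepsilon-x|_{\infty;[0,t]}\Big\|_{L^p}\le C\,t^{\gamma}\varepsilon^{H-\gamma}.$$ In particular, for every $\delta>0$ there is a constant $C_\delta$ such that for all $t\in[\delta,T]$ and $\varepsilon\in(0,1]$ $$\Big\|\,|x^\varepsilon-x|_{C^{\gamma'}([0,t])}\Big\|_{L^p}\le C_\delta\,t^{\gamma}\varepsilon^{H-\gamma}.$$ -/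

import Mathlib

open MeasureTheory ProbabilityTheory Filter Topology Set
open scoped ENNReal

noncomputable section

/-- `B` is a two-sided fractional Brownian motion with Hurst parameter `H` under `P`, normalised by
`B₀ = 0` and `E (B₁)² = 1`: a centred Gaussian process indexed by `ℝ` with the fBM covariance
and almost surely continuous sample paths. -/
structure IsFractionalBrownianMotion {Ω : Type*} [MeasurableSpace Ω] (H : ℝ) (B : ℝ → Ω → ℝ)
    (P : Measure Ω) : Prop where
  gaussian : IsGaussianProcess B P
  centred : ∀ t, ∫ ω, B t ω ∂P = 0
  covariance_eq : ∀ s t, cov[B s, B t; P]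
    = (|s| ^ (2 * H) + |t| ^ (2 * H) - |t - s| ^ (2 * H)) / 2
  continuous_paths : ∀ᵐ ω ∂P, Continuous (fun t => B t ω)

/-- `I` is the limit, as the mesh of the partition `a = t₀ ≤ ⋯ ≤ tₙ = b` tends to `0`, of the sums
`∑ᵢ Ξ (tᵢ, tᵢ₊₁)`. -/
def IsPartitionLimit {E : Type*} [NormedAddCommGroup E] (Ξ : ℝ → ℝ → E) (a b : ℝ) (I : E) : Prop :=
  ∀ η > (0 : ℝ), ∃ δ > (0 : ℝ), ∀ (n : ℕ) (t : ℕ → ℝ), Monotone t → t 0 = a → t n = b →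
    (∀ i < n, t (i + 1) - t i < δ) → ‖∑ i ∈ Finset.range n, Ξ (t i) (t (i + 1)) - I‖ < η

/-- `I = ∫_a^b u dg` as a Riemann–Stieltjes (Young) integral, for a vector-valued integrand `u` and
a real integrator `g`. -/
def IsRSIntegral {E : Type*} [NormedAddCommGroup E] [NormedSpace ℝ E] (u : ℝ → E) (g : ℝ → ℝ)
    (a b : ℝ) (I : E) : Prop :=
  IsPartitionLimit (fun r s => (g s - g r) • u r) a b I

/-- `y` is the path of the stationary fast fractional Ornstein–Uhlenbeck process driven by the path
`b`, i.e. `y t = (σ / ε^H) ∫_{-∞}^t exp (-(t - s) / ε) db_s` for every `t`, the integral being an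
improper Riemann–Stieltjes integral. -/
def IsFastFOU (H σ ε : ℝ) (b y : ℝ → ℝ) : Prop :=
  ∀ t, ∃ J : ℝ → ℝ,
    (∀ a ≤ t, IsRSIntegral (fun s => Real.exp (-(t - s) / ε)) b a t (J a)) ∧
    Tendsto (fun a => σ / ε ^ H * J a) atBot (𝓝 (y t))

/-- `f ∈ C_b³`: `f` is three times continuously differentiable, and `f` and its first three
derivatives are bounded. -/
def IsCb3 {E : Type*} [NormedAddCommGroup E] [NormedSpace ℝ E] (f : E → E) : Prop :=
  ContDiff ℝ 3 f ∧ ∀ i ≤ 3, ∃ C : ℝ, ∀ x, ‖iteratedFDeriv ℝ i f x‖ ≤ C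

/-- `z` solves `ż_t = ε^(H-1) f(z_t) y_t` on `[0, T]` with `z_0 = x₀`. -/
def IsSlowSolution {E : Type*} [NormedAddCommGroup E] [NormedSpace ℝ E] (H ε T : ℝ) (f : E → E)
    (x₀ : E) (y : ℝ → ℝ) (z : ℝ → E) : Prop :=
  z 0 = x₀ ∧ ∀ t ∈ Icc 0 T,
    HasDerivWithinAt z ((ε ^ (H - 1) * y t) • f (z t)) (Icc 0 T) t

/-- The path `u` is `β`-Hölder continuous on `[0, T]`. -/
def IsHolderPath {E : Type*} [NormedAddCommGroup E] (β T : ℝ) (u : ℝ → E) : Prop :=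
  ∃ C : ℝ, ∀ s ∈ Icc 0 T, ∀ t ∈ Icc 0 T, ‖u t - u s‖ ≤ C * |t - s| ^ β

/-- `(X, XX)` is a `β`-Hölder rough path on `[0, T]` over `ℝ`: the two Hölder bounds and
Chen's relation. -/
structure IsRoughPath (β T : ℝ) (X : ℝ → ℝ) (XX : ℝ → ℝ → ℝ) : Prop where
  holder_first : IsHolderPath β T X
  holder_second : ∃ C : ℝ, ∀ s ∈ Icc 0 T, ∀ t ∈ Icc 0 T, |XX s t| ≤ C * |t - s| ^ (2 * β)
  chen : ∀ s ∈ Icc 0 T, ∀ u ∈ Icc 0 T, ∀ t ∈ Icc 0 T,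
    XX s t - XX s u - XX u t = (X u - X s) * (X t - X u)

/-- The canonical (geometric) second level `(X_t - X_s)² / 2` over a scalar path `X`. -/
def geometricLift (X : ℝ → ℝ) (s t : ℝ) : ℝ := (X t - X s) ^ 2 / 2

/-- `z` solves the rough differential equation `dz = f(z) d(X, XX)`, `z_0 = x₀` on `[0, T]`:
for some `β ∈ (1/3, 1/2]`, `(X, XX)` is a `β`-Hölder rough path, `z` is controlled by `X` with
Gubinelli derivative `f(z)`, and `z_t = x₀ + ∫_0^t f(z) d(X, XX)`, the rough integral being the
limit of the sums of `f(z_r) X_{r,s} + Df(z_r) f(z_r) XX_{r,s}`. -/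
def IsRDESolution {E : Type*} [NormedAddCommGroup E] [NormedSpace ℝ E] (T : ℝ) (f : E → E) (x₀ : E)
    (X : ℝ → ℝ) (XX : ℝ → ℝ → ℝ) (z : ℝ → E) : Prop :=
  ∃ β : ℝ, 1 / 3 < β ∧ β ≤ 1 / 2 ∧ IsRoughPath β T X XX ∧ IsHolderPath β T z ∧
    (∃ C : ℝ, ∀ s ∈ Icc 0 T, ∀ t ∈ Icc 0 T,
      ‖z t - z s - (X t - X s) • f (z s)‖ ≤ C * |t - s| ^ (2 * β)) ∧
    ∀ t ∈ Icc 0 T, IsPartitionLimit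
      (fun r s => (X s - X r) • f (z r) + XX r s • fderiv ℝ f (z r) (f (z r))) 0 t (z t - x₀)

/-- `z` solves the Young differential equation `dz = f(z) dX`, `z_0 = x₀` on `[0, T]`. -/
def IsYoungSolution {E : Type*} [NormedAddCommGroup E] [NormedSpace ℝ E] (T : ℝ) (f : E → E)
    (x₀ : E) (X : ℝ → ℝ) (z : ℝ → E) : Prop :=
  ∃ β : ℝ, 1 / 2 < β ∧ β < 1 ∧ IsHolderPath β T X ∧ IsHolderPath β T z ∧
    ∀ t ∈ Icc 0 T, IsRSIntegral (fun s => f (z s)) X 0 t (z t - x₀)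

/-- `sup_{s ∈ [0, t]} ‖u_s‖`, with values in `[0, ∞]`. -/
def supNormOn {E : Type*} [NormedAddCommGroup E] (t : ℝ) (u : ℝ → E) : ℝ≥0∞ :=
  ⨆ s ∈ Icc 0 t, ‖u s‖ₑ

/-- The norm of `C^α([0, t])`, with values in `[0, ∞]`: the supremum norm plus the Hölder seminorm
(terms with `r = s` are `0 / 0 = 0`). -/
def holderNormOn {E : Type*} [NormedAddCommGroup E] (α t : ℝ) (u : ℝ → E) : ℝ≥0∞ :=
  supNormOn t u +
    ⨆ s ∈ Icc 0 t, ⨆ r ∈ Icc 0 t, ‖u s - u r‖ₑ / ENNReal.ofReal (|s - r| ^ α)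

end

/-!
The driver is scalar, so every equation in the statement is solved by the flow `ψ` of the vector
field `f` (the Doss–Sussmann representation): a path `z` with `z 0 = x₀` that follows
`dz = f(z) dX`, in whichever sense, is `z t = ψ (X t - X 0) x₀`. For differentiable `X` this is the
chain rule and uniqueness for ordinary differential equations (`IsFlow.eqOn_of_hasDerivWithinAt`).
For Hölder `X`, Taylor's formula shows that the flow has the required local expansion
(`IsFlow.isRDESolution`, `IsFlow.isYoungSolution`). Conversely, the sewing estimate
`IsPartitionLimit.norm_sub_le` gives for any solution
`z u = ψ (X u - X s) (z s) + O(|u - s| ^ θ)` with `θ > 1`, so that `s ↦ ψ (X t - X s) (z s)` is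
constant (`IsFlow.eqOn_of_isRDESolution`, `IsFlow.eqOn_of_isYoungSolution`).

Integrating by parts, the fast process is `y = σ ε^{-H} (B - A)`, where
`A t = ε⁻¹ ∫_{-∞}^t exp (-(t - s) / ε) B_s ds` is the exponential moving average of `B`; the
integrals converge because the paths of `B` grow subexponentially (`ae_isSubexpAtBot`). Since
`ε A' = B - A`, the slow equation is driven by `σ A`, whence `xε = ψ (σ (A - A 0)) x₀`, while the
limit is `x = ψ (σ B) x₀`. The problem is thus reduced to the difference of the two drivers,
`e = σ (A - A 0) - σ B`.

The increment of `e` over `[s, t]` has Gaussian-type moments: it is the average over an exponential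
time `v` of an expression bounded in `L^q` both by `(ε v)^H` and by `|t - s|^H`, hence by
`(ε v)^(H - γ) |t - s|^γ` (`IsGoodVersion.lintegral_sub_expAverage_rpow_le`). Kolmogorov's estimate
`lintegral_holderSemi_rpow_le`, with its scaling in the length of the interval, turns this into
`‖[e]_{γ';[0,t]}‖_{L^p} ≤ C t^(γ - γ') ε^(H - γ)`. Finally the map `X ↦ ψ X x₀` is locally Lipschitz
in Hölder norm, with a local Lipschitz constant affine in the Hölder seminorms of the paths
(`IsFlow.holderNormOn_sub_le`, from the second difference estimate
`IsFlow.norm_second_difference_le`), and the Cauchy–Schwarz inequality separates that random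
constant from `e`. For the supremum norm the map is globally Lipschitz, and `e 0 = 0` gives the
additional factor `t ^ γ'`.
-/

/-! ### Flows of bounded Lipschitz vector fields -/

section Flow

variable {E : Type*} [NormedAddCommGroup E] [NormedSpace ℝ E]

/-- `f` is a bounded vector field with bounded and Lipschitz derivative; `M` bounds `f` and is a
Lipschitz constant of both `f` and `Df`. -/
structure IsBoundedField (M : NNReal) (f : E → E) : Prop where
  norm_le : ∀ x, ‖f x‖ ≤ M
  lipschitz : LipschitzWith M f
  differentiable : Differentiable ℝ f
  lipschitz_fderiv : LipschitzWith M (fderiv ℝ f)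

/-- `ψ a z` is the position at time `a` of the integral curve of `f` started at `z`. -/
structure IsFlow (f : E → E) (ψ : ℝ → E → E) : Prop where
  zero : ∀ z, ψ 0 z = z
  hasDerivAt : ∀ z a, HasDerivAt (fun b => ψ b z) (f (ψ a z)) a

theorem IsCb3.exists_isBoundedField {f : E → E} (hf : IsCb3 f) :
    ∃ M : NNReal, IsBoundedField M f := by
  obtain ⟨hc, hb⟩ := hf
  obtain ⟨C0, h0⟩ := hb 0 (by norm_num)
  obtain ⟨C1, h1⟩ := hb 1 (by norm_num)
  obtain ⟨C2, h2⟩ := hb 2 (by norm_num)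
  set M : NNReal := Real.toNNReal (max C0 (max C1 C2)) with hM
  have hMle : max C0 (max C1 C2) ≤ (M : ℝ) := Real.le_coe_toNNReal _
  have hC0 : C0 ≤ M := (le_max_left _ _).trans hMle
  have hC1 : C1 ≤ M := ((le_max_left _ _).trans (le_max_right _ _)).trans hMle
  have hC2 : C2 ≤ M := ((le_max_right _ _).trans (le_max_right _ _)).trans hMle
  have hd : Differentiable ℝ f := hc.differentiable (by norm_num)
  have hd2 : Differentiable ℝ (fderiv ℝ f) :=
    (hc.fderiv_right (m := 2) (by norm_num)).differentiable (by norm_num)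
  refine ⟨M, fun x => ?_, ?_, hd, ?_⟩
  · have := h0 x
    rw [norm_iteratedFDeriv_zero] at this
    exact this.trans hC0
  · refine lipschitzWith_of_nnnorm_fderiv_le hd fun x => ?_
    have := h1 x
    rw [norm_iteratedFDeriv_one] at this
    exact_mod_cast this.trans hC1
  · refine lipschitzWith_of_nnnorm_fderiv_le hd2 fun x => ?_
    have := h2 x
    rw [← norm_iteratedFDeriv_fderiv, norm_iteratedFDeriv_one] at this
    exact_mod_cast this.trans hC2

/-- Integral curves of a bounded Lipschitz field exist for all times. -/
theorem exists_hasDerivAt_of_bounded_lipschitz [CompleteSpace E] {f : E → E} {M : NNReal}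
    (hM : ∀ x, ‖f x‖ ≤ M) (hL : LipschitzWith M f) (z : E) :
    ∃ φ : ℝ → E, φ 0 = z ∧ ∀ a, HasDerivAt φ (f (φ a)) a := by
  -- The field being bounded, the Picard–Lindelöf theorem applies on every interval `[-N, N]`.
  have hloc : ∀ n : ℕ, ∃ α : ℝ → E, α 0 = z ∧ ∀ t ∈ Icc (-(n + 1 : ℝ)) (n + 1),
      HasDerivWithinAt α (f (α t)) (Icc (-(n + 1 : ℝ)) (n + 1)) t := by
    intro n
    have h0 : (0 : ℝ) ∈ Icc (-(n + 1 : ℝ)) (n + 1) := ⟨by linarith [n.cast_nonneg (α := ℝ)],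
      by positivity⟩
    have hP : IsPicardLindelof (fun _ => f) (⟨0, h0⟩ : Icc (-(n + 1 : ℝ)) (n + 1)) z
        (M * (n + 1)) 0 M M := by
      refine IsPicardLindelof.of_time_independent (fun x _ => hM x) hL.lipschitzOnWith ?_
      simp
    exact hP.exists_eq_forall_mem_Icc_hasDerivWithinAt₀
  choose α hα0 hα using hloc
  have hder : ∀ (n : ℕ), ∀ t ∈ Ioo (-(n + 1 : ℝ)) (n + 1), HasDerivAt (α n) (f (α n t)) t :=
    fun n t ht => (hα n t (Ioo_subset_Icc_self ht)).hasDerivAt (Icc_mem_nhds ht.1 ht.2)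
  have hagree : ∀ n m : ℕ, n ≤ m → EqOn (α n) (α m) (Ioo (-(n + 1 : ℝ)) (n + 1)) := by
    intro n m hnm
    have hsub : Ioo (-(n + 1 : ℝ)) (n + 1) ⊆ Ioo (-(m + 1 : ℝ)) (m + 1) := by
      have : (n : ℝ) ≤ m := by exact_mod_cast hnm
      exact Ioo_subset_Ioo (by linarith) (by linarith)
    refine ODE_solution_unique_of_mem_Ioo (v := fun _ => f) (s := fun _ => univ) (K := M)
      (t₀ := 0) (fun _ _ => hL.lipschitzOnWith) ⟨by linarith [n.cast_nonneg (α := ℝ)],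
      by positivity⟩ (fun t ht => ⟨hder n t ht, trivial⟩)
      (fun t ht => ⟨hder m t (hsub ht), trivial⟩) (by rw [hα0, hα0])
  have habs : ∀ (b : ℝ) (k : ℕ), |b| < k + 1 → b ∈ Ioo (-(k + 1 : ℝ)) (k + 1) :=
    fun b k h => abs_lt.1 h
  have hmem : ∀ b : ℝ, |b| < (⌈|b|⌉₊ : ℝ) + 1 := fun b => by
    linarith [Nat.le_ceil |b|]
  refine ⟨fun a => α ⌈|a|⌉₊ a, by simp [hα0], fun a => ?_⟩
  set N := ⌈|a|⌉₊ with hN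
  have ha : a ∈ Ioo (-(N + 1 : ℝ)) (N + 1) := habs a N (hmem a)
  refine (hder N a ha).congr_of_eventuallyEq ?_
  filter_upwards [Ioo_mem_nhds ha.1 ha.2] with b hb
  rcases le_total ⌈|b|⌉₊ N with h | h
  · exact hagree _ _ h (habs b _ (hmem b))
  · exact (hagree _ _ h hb).symm

theorem IsBoundedField.exists_isFlow [CompleteSpace E] {f : E → E} {M : NNReal}
    (hf : IsBoundedField M f) : ∃ ψ : ℝ → E → E, IsFlow f ψ := by
  choose φ h0 hd using exists_hasDerivAt_of_bounded_lipschitz hf.norm_le hf.lipschitz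
  exact ⟨fun a z => φ z a, h0, hd⟩

namespace IsFlow

variable {f : E → E} {ψ : ℝ → E → E} {M : NNReal}

theorem continuous (hψ : IsFlow f ψ) (z : E) : Continuous fun a => ψ a z :=
  continuous_iff_continuousAt.2 fun a => (hψ.hasDerivAt z a).continuousAt

theorem add (hψ : IsFlow f ψ) (hL : LipschitzWith M f) (a b : ℝ) (z : E) :
    ψ (a + b) z = ψ a (ψ b z) := by
  have h1 : ∀ t, HasDerivAt (fun a => ψ (a + b) z) (f (ψ (t + b) z)) t := fun t => by
    simpa using (hψ.hasDerivAt z (t + b)).comp_add_const t b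
  have := ODE_solution_unique_univ (v := fun _ => f) (s := fun _ => univ) (K := M) (t₀ := 0)
    (f := fun a => ψ (a + b) z) (g := fun a => ψ a (ψ b z))
    (fun _ => hL.lipschitzOnWith) (fun t => ⟨h1 t, trivial⟩)
    (fun t => ⟨hψ.hasDerivAt _ t, trivial⟩) (by simp [hψ.zero])
  exact congrFun this a

/-- Grönwall's inequality: the flow is Lipschitz in the starting point. -/
theorem dist_le (hψ : IsFlow f ψ) (hL : LipschitzWith M f) (a : ℝ) (z w : E) :
    ‖ψ a z - ψ a w‖ ≤ ‖z - w‖ * Real.exp (M * |a|) := by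
  have key : ∀ (g : E → E), LipschitzWith M g → ∀ (u v : ℝ → E),
      (∀ t, HasDerivAt u (g (u t)) t) → (∀ t, HasDerivAt v (g (v t)) t) →
      ∀ t, 0 ≤ t → ‖u t - v t‖ ≤ ‖u 0 - v 0‖ * Real.exp (M * t) := by
    intro g hg u v hu hv t ht
    have := dist_le_of_trajectories_ODE (v := fun _ => g) (K := M) (a := 0) (b := t) (f := u)
      (g := v) (δ := dist (u 0) (v 0)) (fun _ => hg)
      (fun s _ => (hu s).continuousAt.continuousWithinAt)
      (fun s _ => (hu s).hasDerivWithinAt) (fun s _ => (hv s).continuousAt.continuousWithinAt)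
      (fun s _ => (hv s).hasDerivWithinAt) le_rfl t ⟨ht, le_rfl⟩
    simpa [dist_eq_norm] using this
  rcases le_total 0 a with ha | ha
  · simpa [hψ.zero, abs_of_nonneg ha] using key f hL _ _ (hψ.hasDerivAt z) (hψ.hasDerivAt w) a ha
  · -- For negative times, follow the flow of `-f`.
    have hrev : ∀ z t, HasDerivAt (fun s => ψ (-s) z) (-f (ψ (-t) z)) t := fun z t => by
      have := (hψ.hasDerivAt z (-t)).scomp t (hasDerivAt_neg t)
      rwa [neg_one_smul] at this
    have := key (fun x => -f x) hL.neg _ _ (hrev z) (hrev w) (-a) (by linarith)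
    simpa [hψ.zero, abs_of_nonpos ha] using this

theorem norm_sub_le (hψ : IsFlow f ψ) (hM : ∀ x, ‖f x‖ ≤ M) (a b : ℝ) (z : E) :
    ‖ψ a z - ψ b z‖ ≤ M * |a - b| := by
  have := Convex.norm_image_sub_le_of_norm_hasDerivWithin_le (s := univ) (f := fun a => ψ a z)
    (f' := fun a => f (ψ a z)) (C := M) (x := b) (y := a)
    (fun x _ => (hψ.hasDerivAt z x).hasDerivWithinAt) (fun x _ => hM _) convex_univ trivial trivial
  simpa using this

/-- A function on the line vanishing at `0` with derivative bounded by `C` on `[0, a]`. -/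
theorem norm_le_of_deriv_bound {k k' : ℝ → E} {C a : ℝ} (h0 : k 0 = 0)
    (hk : ∀ b, HasDerivAt k (k' b) b) (hb : ∀ b, |b| ≤ |a| → ‖k' b‖ ≤ C) :
    ‖k a‖ ≤ C * |a| := by
  have := Convex.norm_image_sub_le_of_norm_hasDerivWithin_le (s := uIcc 0 a) (f := k)
    (f' := k') (C := C) (x := 0) (y := a)
    (fun x _ => (hk x).hasDerivWithinAt)
    (fun x hx => hb x (by simpa using abs_sub_left_of_mem_uIcc hx))
    (convex_uIcc 0 a) left_mem_uIcc right_mem_uIcc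
  simpa [h0] using this

theorem norm_sub_taylor_one_le (hψ : IsFlow f ψ) (hf : IsBoundedField M f) (a : ℝ) (z : E) :
    ‖ψ a z - z - a • f z‖ ≤ M ^ 2 * |a| ^ 2 := by
  have h := norm_le_of_deriv_bound (k := fun b => ψ b z - z - b • f z)
    (k' := fun b => f (ψ b z) - f z) (C := M ^ 2 * |a|) (a := a) (by simp [hψ.zero])
    (fun b => by
      simpa using ((hψ.hasDerivAt z b).sub_const z).fun_sub ((hasDerivAt_id b).smul_const (f z)))
    (fun b hb => by
      calc ‖f (ψ b z) - f z‖ ≤ M * ‖ψ b z - z‖ := hf.lipschitz.norm_sub_le _ _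
        _ ≤ M * (M * |b|) := by
            have := hψ.norm_sub_le hf.norm_le b 0 z
            rw [hψ.zero, sub_zero] at this
            gcongr
        _ ≤ M ^ 2 * |a| := by rw [sq, mul_assoc]; gcongr)
  calc _ ≤ M ^ 2 * |a| * |a| := h
    _ = _ := by ring

end IsFlow

theorem IsBoundedField.norm_fderiv_le {f : E → E} {M : NNReal} (hf : IsBoundedField M f) (x : E) :
    ‖fderiv ℝ f x‖ ≤ M := norm_fderiv_le_of_lipschitz ℝ hf.lipschitz

theorem IsBoundedField.norm_fderiv_apply_sub_le {f : E → E} {M : NNReal} (hf : IsBoundedField M f)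
    (x y : E) : ‖fderiv ℝ f x (f x) - fderiv ℝ f y (f y)‖ ≤ 2 * M ^ 2 * ‖x - y‖ := by
  have h : fderiv ℝ f x (f x) - fderiv ℝ f y (f y)
      = (fderiv ℝ f x - fderiv ℝ f y) (f x) + fderiv ℝ f y (f x - f y) := by
    simp
  rw [h]
  calc _ ≤ ‖(fderiv ℝ f x - fderiv ℝ f y) (f x)‖ + ‖fderiv ℝ f y (f x - f y)‖ := norm_add_le _ _
    _ ≤ ‖fderiv ℝ f x - fderiv ℝ f y‖ * ‖f x‖ + ‖fderiv ℝ f y‖ * ‖f x - f y‖ :=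
        add_le_add (ContinuousLinearMap.le_opNorm _ _) (ContinuousLinearMap.le_opNorm _ _)
    _ ≤ (M * ‖x - y‖) * M + M * (M * ‖x - y‖) := by
        gcongr
        exacts [hf.lipschitz_fderiv.norm_sub_le _ _, hf.norm_le x, hf.norm_fderiv_le y,
          hf.lipschitz.norm_sub_le _ _]
    _ = _ := by ring

theorem IsFlow.norm_sub_taylor_two_le {f : E → E} {ψ : ℝ → E → E} {M : NNReal} (hψ : IsFlow f ψ)
    (hf : IsBoundedField M f) (a : ℝ) (z : E) :
    ‖ψ a z - z - a • f z - (a ^ 2 / 2) • fderiv ℝ f z (f z)‖ ≤ 2 * M ^ 3 * |a| ^ 3 := by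
  have h1 : ∀ b, |b| ≤ |a| →
      ‖f (ψ b z) - f z - b • fderiv ℝ f z (f z)‖ ≤ 2 * M ^ 3 * |a| ^ 2 := by
    intro b hba
    have h := IsFlow.norm_le_of_deriv_bound
      (k := fun b => f (ψ b z) - f z - b • fderiv ℝ f z (f z))
      (k' := fun b => fderiv ℝ f (ψ b z) (f (ψ b z)) - fderiv ℝ f z (f z))
      (C := 2 * M ^ 3 * |a|) (a := b) (by simp [hψ.zero])
      (fun c => by
        have hc := (hf.differentiable (ψ c z)).hasFDerivAt.comp_hasDerivAt c (hψ.hasDerivAt z c)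
        simpa using (hc.sub_const (f z)).fun_sub ((hasDerivAt_id c).smul_const _))
      (fun c hc => by
        have h2 := hψ.norm_sub_le hf.norm_le c 0 z
        rw [hψ.zero, sub_zero] at h2
        calc _ ≤ 2 * M ^ 2 * ‖ψ c z - z‖ := hf.norm_fderiv_apply_sub_le _ _
          _ ≤ 2 * M ^ 2 * (M * |a|) := by
              gcongr
              exact h2.trans (mul_le_mul_of_nonneg_left (hc.trans hba) M.2)
          _ = _ := by ring)
    calc _ ≤ 2 * M ^ 3 * |a| * |b| := h
      _ ≤ 2 * M ^ 3 * |a| * |a| := by gcongr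
      _ = _ := by ring
  have h := IsFlow.norm_le_of_deriv_bound
    (k := fun b => ψ b z - z - b • f z - (b ^ 2 / 2) • fderiv ℝ f z (f z))
    (k' := fun b => f (ψ b z) - f z - b • fderiv ℝ f z (f z))
    (C := 2 * M ^ 3 * |a| ^ 2) (a := a) (by simp [hψ.zero])
    (fun b => by
      have h2 : HasDerivAt (fun b : ℝ => b ^ 2 / 2) b b := by
        simpa using (hasDerivAt_pow 2 b).div_const 2
      simpa using (((hψ.hasDerivAt z b).sub_const z).fun_sub
        ((hasDerivAt_id b).smul_const (f z))).fun_sub (h2.smul_const _)) h1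
  calc _ ≤ 2 * M ^ 3 * |a| ^ 2 * |a| := h
    _ = _ := by ring

/-- The second difference of the flow over two scalar paths `b` and `b + e`: it is controlled by the
increment of `e` and by the value of `e` times the increments of the paths. -/
theorem IsFlow.norm_second_difference_le {f : E → E} {ψ : ℝ → E → E} {M : NNReal}
    (hψ : IsFlow f ψ) (hM : ∀ x, ‖f x‖ ≤ M) (hL : LipschitzWith M f) (z : E) (b b' e e' : ℝ) :
    ‖(ψ (b + e) z - ψ b z) - (ψ (b' + e') z - ψ b' z)‖
      ≤ M * |e - e'| + M ^ 2 * (|b - b'| + |e - e'|) * |e'| := by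
  have hd : ∀ c d θ : ℝ, HasDerivAt (fun θ : ℝ => ψ (c + θ * d) z) (d • f (ψ (c + θ * d) z)) θ := by
    intro c d θ
    have h1 : HasDerivAt (fun θ : ℝ => c + θ * d) d θ := by
      simpa using ((hasDerivAt_id θ).mul_const d).const_add c
    exact (hψ.hasDerivAt z (c + θ * d)).scomp θ h1
  have h := norm_image_sub_le_of_norm_deriv_le_segment_01'
    (f := fun θ : ℝ => ψ (b + θ * e) z - ψ (b' + θ * e') z)
    (f' := fun θ : ℝ => e • f (ψ (b + θ * e) z) - e' • f (ψ (b' + θ * e') z))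
    (C := M * |e - e'| + M ^ 2 * (|b - b'| + |e - e'|) * |e'|)
    (fun θ _ => ((hd b e θ).sub (hd b' e' θ)).hasDerivWithinAt)
    (fun θ hθ => by
      have h1 : e • f (ψ (b + θ * e) z) - e' • f (ψ (b' + θ * e') z)
          = (e - e') • f (ψ (b + θ * e) z)
            + e' • (f (ψ (b + θ * e) z) - f (ψ (b' + θ * e') z)) := by
        module
      rw [h1]
      refine (norm_add_le _ _).trans ?_
      rw [norm_smul, norm_smul, Real.norm_eq_abs, Real.norm_eq_abs]
      have h2 : ‖f (ψ (b + θ * e) z) - f (ψ (b' + θ * e') z)‖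
          ≤ M * (M * (|b - b'| + |e - e'|)) := by
        refine (hL.norm_sub_le _ _).trans ?_
        gcongr
        refine (hψ.norm_sub_le hM _ _ z).trans ?_
        gcongr
        have h3 : b + θ * e - (b' + θ * e') = (b - b') + θ * (e - e') := by ring
        rw [h3]
        refine (abs_add_le _ _).trans ?_
        rw [abs_mul, abs_of_nonneg hθ.1]
        have := mul_le_mul_of_nonneg_right hθ.2.le (abs_nonneg (e - e'))
        linarith
      have h4 := mul_le_mul_of_nonneg_left (hM (ψ (b + θ * e) z)) (abs_nonneg (e - e'))
      have h5 := mul_le_mul_of_nonneg_left h2 (abs_nonneg e')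
      nlinarith)
  convert h using 2
  simp
  abel

/-- Along a `C¹` scalar path `X`, the equation `ż = Ẋ f(z)` has no solution other than the flow of
`f` evaluated along `X`. -/
theorem IsFlow.eqOn_of_hasDerivWithinAt {f : E → E} {ψ : ℝ → E → E} {M : NNReal}
    (hψ : IsFlow f ψ) (hL : LipschitzWith M f) {X c : ℝ → ℝ} (hX : ∀ t, HasDerivAt X (c t) t)
    (hc : Continuous c) {T : ℝ} {z : ℝ → E} {x₀ : E} (h0 : z 0 = x₀)
    (hz : ∀ t ∈ Icc 0 T, HasDerivWithinAt z (c t • f (z t)) (Icc 0 T) t) :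
    EqOn z (fun t => ψ (X t - X 0) x₀) (Icc 0 T) := by
  obtain ⟨R, hR⟩ := isCompact_Icc.exists_bound_of_continuousOn (s := Icc 0 T) hc.continuousOn
  have hw : ∀ t, HasDerivAt (fun t => ψ (X t - X 0) x₀) (c t • f (ψ (X t - X 0) x₀)) t :=
    fun t =>
    (hψ.hasDerivAt x₀ (X t - X 0)).scomp (h := fun t => X t - X 0) t ((hX t).sub_const (X 0))
  refine ODE_solution_unique_of_mem_Icc_right (v := fun t x => c t • f x) (s := fun _ => univ)
    (K := Real.toNNReal R * M) (fun t ht => ?_) (fun t ht => (hz t ht).continuousWithinAt)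
    (fun t ht => ?_) (fun _ _ => trivial) (fun t _ => (hw t).continuousAt.continuousWithinAt)
    (fun t _ => (hw t).hasDerivWithinAt) (fun _ _ => trivial) (by simp [h0, hψ.zero])
  · refine LipschitzWith.lipschitzOnWith (LipschitzWith.of_dist_le_mul fun x y => ?_)
    have h1 : |c t| ≤ Real.toNNReal R :=
      (hR t (Ico_subset_Icc_self ht)).trans (Real.le_coe_toNNReal R)
    rw [dist_eq_norm, dist_eq_norm, ← smul_sub, norm_smul, NNReal.coe_mul, mul_assoc,
      Real.norm_eq_abs]
    gcongr
    exact hL.norm_sub_le _ _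
  · exact (hz t (Ico_subset_Icc_self ht)).mono_of_mem_nhdsWithin (Icc_mem_nhdsGE_of_mem ht)

end Flow

/-! ### Limits along partitions and the sewing estimate -/

section Sewing

variable {E : Type*} [NormedAddCommGroup E]

theorem exists_fine_partition {a b δ : ℝ} (hab : a ≤ b) (hδ : 0 < δ) :
    ∃ (n : ℕ) (p : ℕ → ℝ), Monotone p ∧ p 0 = a ∧ p n = b ∧ ∀ i < n, p (i + 1) - p i < δ := by
  obtain ⟨n, hn⟩ := exists_nat_gt ((b - a) / δ)
  have hn0 : (0 : ℝ) < n := (div_nonneg (by linarith) hδ.le).trans_lt hn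
  refine ⟨n, fun i => a + (b - a) * (min i n : ℕ) / n, fun i j hij => ?_, by simp, ?_, ?_⟩
  · have : ((min i n : ℕ) : ℝ) ≤ (min j n : ℕ) := by exact_mod_cast min_le_min_right n hij
    have h0 : 0 ≤ b - a := by linarith
    simp only
    gcongr
  · have : (n : ℝ) ≠ 0 := hn0.ne'
    simp [this]
  · intro i hi
    have h1 : min (i + 1) n = i + 1 := by omega
    have h2 : min i n = i := by omega
    simp only [h1, h2]
    rw [div_lt_iff₀ hδ] at hn
    have : a + (b - a) * ((i + 1 : ℕ) : ℝ) / n - (a + (b - a) * (i : ℝ) / n) = (b - a) / n := by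
      push_cast; ring
    rw [this, div_lt_iff₀ hn0]
    linarith

theorem IsPartitionLimit.eq_zero_of_self {Ξ : ℝ → ℝ → E} {a : ℝ} {I : E}
    (h : IsPartitionLimit Ξ a a I) : I = 0 := by
  by_contra hI
  obtain ⟨δ, -, h⟩ := h ‖I‖ (norm_pos_iff.2 hI)
  have := h 0 (fun _ => a) monotone_const rfl rfl (by simp)
  simp at this

/-- Limits along partitions are additive over intervals. -/
theorem IsPartitionLimit.sub {Ξ : ℝ → ℝ → E} {a s t : ℝ} {I J : E} (has : a ≤ s)
    (hI : IsPartitionLimit Ξ a s I) (hJ : IsPartitionLimit Ξ a t J) :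
    IsPartitionLimit Ξ s t (J - I) := by
  intro η hη
  obtain ⟨δ₁, hδ₁, h₁⟩ := hI (η / 2) (half_pos hη)
  obtain ⟨δ₂, hδ₂, h₂⟩ := hJ (η / 2) (half_pos hη)
  refine ⟨min δ₁ δ₂, lt_min hδ₁ hδ₂, fun n q hq hq0 hqn hqd => ?_⟩
  obtain ⟨m, p, hp, hp0, hpm, hpd⟩ := exists_fine_partition has (lt_min hδ₁ hδ₂)
  -- Concatenate a fine partition of `[a, s]` with the given partition of `[s, t]`.
  set τ : ℕ → ℝ := fun i => if i ≤ m then p i else q (i - m) with hτ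
  have hτ1 : ∀ i ≤ m, τ i = p i := fun i hi => by simp [hτ, hi]
  have hτ2 : ∀ i, τ (m + i) = q i := fun i => by
    rcases Nat.eq_zero_or_pos i with rfl | hi
    · simp [hτ, hpm, hq0]
    · simp [hτ, hi.ne']
  have hmono : Monotone τ := by
    refine monotone_nat_of_le_succ fun i => ?_
    rcases lt_or_ge i m with h | h
    · rw [hτ1 i h.le, hτ1 (i + 1) h]; exact hp (Nat.le_succ i)
    · obtain ⟨j, rfl⟩ := Nat.exists_eq_add_of_le h
      rw [hτ2, add_assoc, hτ2]; exact hq (Nat.le_succ j)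
  have hd : ∀ i < m + n, τ (i + 1) - τ i < δ₂ := by
    intro i hi
    rcases lt_or_ge i m with h | h
    · rw [hτ1 i h.le, hτ1 (i + 1) h]; exact (hpd i h).trans_le (min_le_right _ _)
    · obtain ⟨j, rfl⟩ := Nat.exists_eq_add_of_le h
      rw [hτ2, add_assoc, hτ2]; exact (hqd j (by omega)).trans_le (min_le_right _ _)
  have e1 := h₁ m p hp hp0 hpm fun i hi => (hpd i hi).trans_le (min_le_left _ _)
  have e2 := h₂ (m + n) τ hmono (by rw [hτ1 0 (Nat.zero_le _), hp0]) (by rw [hτ2, hqn]) hd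
  have hs : ∑ i ∈ Finset.range (m + n), Ξ (τ i) (τ (i + 1))
      = ∑ i ∈ Finset.range m, Ξ (p i) (p (i + 1)) + ∑ i ∈ Finset.range n, Ξ (q i) (q (i + 1)) := by
    rw [Finset.sum_range_add]
    congr 1
    · refine Finset.sum_congr rfl fun i hi => ?_
      have hi := Finset.mem_range.1 hi
      rw [hτ1 i hi.le, hτ1 (i + 1) hi]
    · refine Finset.sum_congr rfl fun i _ => ?_
      rw [hτ2, add_assoc, hτ2]
  rw [hs] at e2
  set S₁ := ∑ i ∈ Finset.range m, Ξ (p i) (p (i + 1))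
  set S₂ := ∑ i ∈ Finset.range n, Ξ (q i) (q (i + 1))
  calc ‖S₂ - (J - I)‖ = ‖(S₁ + S₂ - J) - (S₁ - I)‖ := by congr 1; abel
    _ ≤ ‖S₁ + S₂ - J‖ + ‖S₁ - I‖ := norm_sub_le _ _
    _ < η := by linarith

/-- Partition sums of a germ `Ξ` converge to the increment of any path whose increments agree with
`Ξ` up to an error `o(u - s)`, uniformly. -/
theorem isPartitionLimit_of_forall_eps {Ξ : ℝ → ℝ → E} {w : ℝ → E} {a b : ℝ}
    (h : ∀ κ > 0, ∃ δ > 0, ∀ s u, a ≤ s → s ≤ u → u ≤ b → u - s < δ →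
      ‖w u - w s - Ξ s u‖ ≤ κ * (u - s)) :
    IsPartitionLimit Ξ a b (w b - w a) := by
  intro η hη
  obtain ⟨δ, hδ, h⟩ := h (η / (|b - a| + 1)) (by positivity)
  refine ⟨δ, hδ, fun n p hp hp0 hpn hpd => ?_⟩
  have htel : ∑ i ∈ Finset.range n, (w (p (i + 1)) - w (p i)) = w b - w a := by
    rw [Finset.sum_range_sub (fun i => w (p i)), hp0, hpn]
  have htel' : ∑ i ∈ Finset.range n, (p (i + 1) - p i) = b - a := by
    rw [Finset.sum_range_sub p, hp0, hpn]
  rw [← norm_neg, neg_sub, ← htel, ← Finset.sum_sub_distrib]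
  calc _ ≤ ∑ i ∈ Finset.range n, η / (|b - a| + 1) * (p (i + 1) - p i) := by
        refine norm_sum_le_of_le _ fun i hi => ?_
        have hi := Finset.mem_range.1 hi
        exact h _ _ (hp0 ▸ hp (Nat.zero_le i)) (hp (Nat.le_succ i)) (hpn ▸ hp hi) (hpd i hi)
    _ = η * ((b - a) / (|b - a| + 1)) := by rw [← Finset.mul_sum, htel']; ring
    _ < η := by
        refine mul_lt_of_lt_one_right hη ?_
        rw [div_lt_one (by positivity)]
        linarith [le_abs_self (b - a)]

theorem isPartitionLimit_of_norm_sub_le {Ξ : ℝ → ℝ → E} {w : ℝ → E} {a b C θ : ℝ}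
    (hθ : 1 < θ) (h : ∀ s u, a ≤ s → s ≤ u → u ≤ b → ‖w u - w s - Ξ s u‖ ≤ C * (u - s) ^ θ) :
    IsPartitionLimit Ξ a b (w b - w a) := by
  refine isPartitionLimit_of_forall_eps fun κ hκ => ?_
  have ht : Tendsto (fun δ : ℝ => |C| * δ ^ (θ - 1)) (𝓝[>] 0) (𝓝 0) := by
    have h1 : Tendsto (fun δ : ℝ => δ ^ (θ - 1)) (𝓝[>] 0) (𝓝 0) := by
      have := (Real.continuousAt_rpow_const 0 (θ - 1) (Or.inr (by linarith))).tendsto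
      rw [Real.zero_rpow (by linarith)] at this
      exact this.mono_left nhdsWithin_le_nhds
    simpa using h1.const_mul |C|
  obtain ⟨δ, hδ, hδ0⟩ := ((ht.eventually_lt_const hκ).and self_mem_nhdsWithin).exists
  refine ⟨δ, hδ0, fun s u hs hsu hu hd => (h s u hs hsu hu).trans ?_⟩
  have h0 : 0 ≤ u - s := by linarith
  have h1 : (u - s) ^ θ = (u - s) ^ (θ - 1) * (u - s) := by
    rcases h0.eq_or_lt with h0 | h0
    · rw [← h0, Real.zero_rpow (by linarith), mul_zero]
    · rw [Real.rpow_sub_one h0.ne', div_mul_cancel₀ _ h0.ne']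
  rw [h1, ← mul_assoc]
  refine mul_le_mul_of_nonneg_right (le_trans ?_ hδ.le) h0
  gcongr
  exact le_abs_self C

/-- A path with increments of order `θ > 1` is constant. -/
theorem eq_of_norm_sub_le_rpow {h : ℝ → E} {a b C θ : ℝ} (hab : a ≤ b) (hθ : 1 < θ)
    (hh : ∀ s u, a ≤ s → s ≤ u → u ≤ b → ‖h u - h s‖ ≤ C * (u - s) ^ θ) : h b = h a := by
  have hl := isPartitionLimit_of_norm_sub_le (Ξ := fun _ _ => 0) (w := h) hθ (by simpa using hh)
  by_contra hne
  obtain ⟨δ, hδ, hl⟩ := hl ‖h b - h a‖ (norm_pos_iff.2 (sub_ne_zero.2 hne))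
  obtain ⟨n, p, hp, hp0, hpn, hpd⟩ := exists_fine_partition hab hδ
  have := hl n p hp hp0 hpn hpd
  simp [norm_sub_rev] at this

theorem sum_range_two_mul {M : Type*} [AddCommMonoid M] (g : ℕ → M) (m : ℕ) :
    ∑ j ∈ Finset.range (2 * m), g j = ∑ i ∈ Finset.range m, (g (2 * i) + g (2 * i + 1)) := by
  induction m with
  | zero => simp
  | succ k ih =>
    rw [Finset.sum_range_succ, ← ih, show 2 * (k + 1) = 2 * k + 1 + 1 by ring,
      Finset.sum_range_succ, Finset.sum_range_succ, add_assoc]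

/-- The sewing estimate: if the defect of additivity of `Ξ` is of order `θ > 1`, the limit of its
partition sums differs from `Ξ a b` by a term of order `θ`. -/
theorem IsPartitionLimit.norm_sub_le {Ξ : ℝ → ℝ → E} {a b C θ : ℝ} {I : E} (hab : a ≤ b)
    (hθ : 1 < θ) (hI : IsPartitionLimit Ξ a b I)
    (h : ∀ r u v, a ≤ r → r ≤ u → u ≤ v → v ≤ b →
      ‖Ξ r v - Ξ r u - Ξ u v‖ ≤ C * (v - r) ^ θ) :
    ‖I - Ξ a b‖ ≤ C * (1 - 2 ^ (1 - θ))⁻¹ * (b - a) ^ θ := by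
  set q : ℕ → ℕ → ℝ := fun n i => a + (b - a) * i / 2 ^ n with hq
  set S : ℕ → E := fun n => ∑ i ∈ Finset.range (2 ^ n), Ξ (q n i) (q n (i + 1)) with hS
  have hba : 0 ≤ b - a := by linarith
  have hstep : ∀ n i, q n (i + 1) - q n i = (b - a) / 2 ^ n := fun n i => by
    simp only [hq]; push_cast; ring
  have hmono : ∀ n, Monotone (q n) := fun n => monotone_nat_of_le_succ fun i => by
    have := hstep n i
    have h2 : 0 ≤ (b - a) / 2 ^ n := by positivity
    linarith
  have hq0 : ∀ n, q n 0 = a := fun n => by simp [hq]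
  have hqn : ∀ n, q n (2 ^ n) = b := fun n => by simp [hq]
  have hS0 : S 0 = Ξ a b := by simp [hS, hq]
  have hlim : Tendsto S atTop (𝓝 I) := by
    rw [Metric.tendsto_atTop]
    intro η hη
    obtain ⟨δ, hδ, hI⟩ := hI η hη
    have ht : Tendsto (fun n : ℕ => (b - a) / (2 : ℝ) ^ n) atTop (𝓝 0) := by
      have := (tendsto_pow_atTop_nhds_zero_of_lt_one (r := (1 / 2 : ℝ)) (by norm_num)
        (by norm_num)).const_mul (b - a)
      simpa [div_eq_mul_inv] using this
    obtain ⟨N, hN⟩ := (ht.eventually_lt_const hδ).exists_forall_of_atTop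
    refine ⟨N, fun n hn => ?_⟩
    rw [dist_eq_norm]
    exact hI (2 ^ n) (q n) (hmono n) (hq0 n) (hqn n) fun i _ => by rw [hstep]; exact hN n hn
  have hr : (2 : ℝ) ^ (1 - θ) < 1 := Real.rpow_lt_one_of_one_lt_of_neg (by norm_num) (by linarith)
  have hgeo : ∀ n, dist (S n) (S (n + 1)) ≤ C * (b - a) ^ θ * ((2 : ℝ) ^ (1 - θ)) ^ n := by
    intro n
    have hq2 : ∀ i, q (n + 1) (2 * i) = q n i := fun i => by
      simp only [hq, pow_succ]; push_cast; field_simp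
    have hSn : S (n + 1) = ∑ i ∈ Finset.range (2 ^ n),
        (Ξ (q (n + 1) (2 * i)) (q (n + 1) (2 * i + 1))
          + Ξ (q (n + 1) (2 * i + 1)) (q (n + 1) (2 * i + 1 + 1))) := by
      simp only [hS]
      rw [pow_succ, mul_comm, sum_range_two_mul]
    rw [dist_eq_norm, hSn]
    simp only [hS]
    rw [← Finset.sum_sub_distrib]
    calc _ ≤ ∑ i ∈ Finset.range (2 ^ n), C * ((b - a) / 2 ^ n) ^ θ := by
          refine norm_sum_le_of_le _ fun i hi => ?_
          have hi := Finset.mem_range.1 hi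
          have h3 := h (q (n + 1) (2 * i)) (q (n + 1) (2 * i + 1)) (q (n + 1) (2 * (i + 1)))
            (by rw [← hq0 (n + 1)]; exact hmono _ (Nat.zero_le _)) (hmono _ (by omega))
            (hmono _ (by omega)) (by
              rw [← hqn (n + 1)]; exact hmono _ (by rw [pow_succ]; omega))
          rw [hq2, hq2, hstep n i] at h3
          rw [hq2, show 2 * i + 1 + 1 = 2 * (i + 1) by ring, hq2, ← sub_sub]
          exact h3
      _ = C * (b - a) ^ θ * ((2 : ℝ) ^ (1 - θ)) ^ n := by
          rw [Finset.sum_const, Finset.card_range, nsmul_eq_mul, Real.div_rpow hba (by positivity),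
            Real.rpow_sub (by norm_num), Real.rpow_one, div_pow, ← Real.rpow_natCast,
            ← Real.rpow_natCast, ← Real.rpow_mul (by norm_num), ← Real.rpow_mul (by norm_num),
            mul_comm θ]
          simp only [Nat.cast_pow, Nat.cast_ofNat]
          rw [Real.rpow_natCast]
          ring
  have := dist_le_of_le_geometric_of_tendsto₀ _ _ hr hgeo hlim
  rw [hS0, dist_comm, dist_eq_norm] at this
  calc _ ≤ _ := this
    _ = _ := by ring

end Sewing

/-! ### Rough and Young equations driven by a scalar path -/

section RDE

variable {E : Type*} [NormedAddCommGroup E] [NormedSpace ℝ E]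

theorem IsHolderPath.exists_nonneg {E : Type*} [NormedAddCommGroup E] {β T : ℝ} {u : ℝ → E}
    (h : IsHolderPath β T u) : ∃ C : ℝ, 0 ≤ C ∧ ∀ s ∈ Icc 0 T, ∀ t ∈ Icc 0 T,
      ‖u t - u s‖ ≤ C * |t - s| ^ β := by
  obtain ⟨C, hC⟩ := h
  refine ⟨|C|, abs_nonneg C, fun s hs t ht => (hC s hs t ht).trans ?_⟩
  gcongr
  exact le_abs_self C

/-- A path whose increments follow the flow of `f` over the increments of `X`, up to an error of
order `θ > 1`, is the flow evaluated at `X`: the path `s ↦ ψ (X t - X s) (z s)` is constant, for its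
increments are of order `θ` as well. -/
theorem IsFlow.eq_of_norm_sub_le {f : E → E} {ψ : ℝ → E → E} {M : NNReal} (hψ : IsFlow f ψ)
    (hL : LipschitzWith M f) {X : ℝ → ℝ} {z : ℝ → E} {t R C θ : ℝ} (ht : 0 ≤ t) (hθ : 1 < θ)
    (hX : ∀ s u, 0 ≤ s → s ≤ u → u ≤ t → |X u - X s| ≤ R)
    (hz : ∀ s u, 0 ≤ s → s ≤ u → u ≤ t → ‖z u - ψ (X u - X s) (z s)‖ ≤ C * (u - s) ^ θ) :
    z t = ψ (X t - X 0) (z 0) := by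
  have h := eq_of_norm_sub_le_rpow (h := fun s => ψ (X t - X s) (z s))
    (C := C * Real.exp (M * R)) ht hθ (fun s u hs hsu hut => by
      have h1 : ψ (X t - X s) (z s) = ψ (X t - X u) (ψ (X u - X s) (z s)) := by
        rw [← hψ.add hL]; congr 1; ring
      rw [h1]
      refine (hψ.dist_le hL _ _ _).trans ?_
      have h2 : Real.exp (M * |X t - X u|) ≤ Real.exp (M * R) := by
        gcongr
        exact hX u t (hs.trans hsu) hut le_rfl
      calc _ ≤ (C * (u - s) ^ θ) * Real.exp (M * R) := by
            gcongr
            · exact (norm_nonneg _).trans (hz s u hs hsu hut)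
            · exact hz s u hs hsu hut
        _ = _ := by ring)
  simpa [hψ.zero] using h

/-- Taylor's formula of order one, with quadratic remainder. -/
theorem IsBoundedField.norm_sub_fderiv_le {f : E → E} {M : NNReal} (hf : IsBoundedField M f)
    (x y : E) : ‖f y - f x - fderiv ℝ f x (y - x)‖ ≤ M * ‖y - x‖ ^ 2 := by
  have h := Convex.norm_image_sub_le_of_norm_hasFDerivWithin_le' (𝕜 := ℝ) (s := segment ℝ x y)
    (f := f) (f' := fderiv ℝ f) (φ := fderiv ℝ f x) (C := M * ‖y - x‖) (x := x) (y := y)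
    (fun w _ => (hf.differentiable w).hasFDerivAt.hasFDerivWithinAt)
    (fun w hw => (hf.lipschitz_fderiv.norm_sub_le w x).trans (by
      gcongr
      exact norm_sub_le_of_mem_segment hw))
    (convex_segment x y) (left_mem_segment ℝ x y) (right_mem_segment ℝ x y)
  calc _ ≤ _ := h
    _ = _ := by ring

theorem rpow_pow_eq_rpow_mul {x β : ℝ} (hx : 0 ≤ x) (n : ℕ) : (x ^ β) ^ n = x ^ (n * β) := by
  rw [mul_comm, Real.rpow_mul hx, Real.rpow_natCast]

/-- The additivity defect of the second order germ of the rough integral `∫ f(z) dX`. Here `ℓ`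
stands for `(v - r) ^ β`, in terms of which the defect is cubic. -/
theorem IsBoundedField.norm_rough_defect_le {f : E → E} {M : NNReal} (hf : IsBoundedField M f)
    {X : ℝ → ℝ} {z : ℝ → E} {r u v ℓ A D G : ℝ} (hA : 0 ≤ A) (hℓ : 0 ≤ ℓ)
    (hXuv : |X v - X u| ≤ A * ℓ) (hz : ‖z u - z r‖ ≤ D * ℓ)
    (hg : ‖z u - z r - (X u - X r) • f (z r)‖ ≤ G * ℓ ^ 2) :
    ‖((X v - X r) • f (z r) + geometricLift X r v • fderiv ℝ f (z r) (f (z r)))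
      - ((X u - X r) • f (z r) + geometricLift X r u • fderiv ℝ f (z r) (f (z r)))
      - ((X v - X u) • f (z u) + geometricLift X u v • fderiv ℝ f (z u) (f (z u)))‖
      ≤ (A * (M * D ^ 2 + M * G) + A ^ 2 * M ^ 2 * D) * ℓ ^ 3 := by
  have hid : ((X v - X r) • f (z r) + geometricLift X r v • fderiv ℝ f (z r) (f (z r)))
      - ((X u - X r) • f (z r) + geometricLift X r u • fderiv ℝ f (z r) (f (z r)))
      - ((X v - X u) • f (z u) + geometricLift X u v • fderiv ℝ f (z u) (f (z u)))
      = -((X v - X u) • ((f (z u) - f (z r) - fderiv ℝ f (z r) (z u - z r))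
          + fderiv ℝ f (z r) (z u - z r - (X u - X r) • f (z r))))
        - geometricLift X u v •
          (fderiv ℝ f (z u) (f (z u)) - fderiv ℝ f (z r) (f (z r))) := by
    simp only [map_sub, map_smul, geometricLift]
    module
  rw [hid]
  have hD : 0 ≤ D * ℓ := (norm_nonneg _).trans hz
  have h1 : ‖f (z u) - f (z r) - fderiv ℝ f (z r) (z u - z r)‖ ≤ M * (D * ℓ) ^ 2 :=
    (hf.norm_sub_fderiv_le _ _).trans (by gcongr)
  have h2 : ‖fderiv ℝ f (z r) (z u - z r - (X u - X r) • f (z r))‖ ≤ M * (G * ℓ ^ 2) :=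
    ((fderiv ℝ f (z r)).le_opNorm _).trans
      (mul_le_mul (hf.norm_fderiv_le _) hg (norm_nonneg _) M.2)
  have h3 : ‖fderiv ℝ f (z u) (f (z u)) - fderiv ℝ f (z r) (f (z r))‖ ≤ 2 * M ^ 2 * (D * ℓ) :=
    (hf.norm_fderiv_apply_sub_le _ _).trans (by gcongr)
  have h4 : ‖geometricLift X u v‖ ≤ (A * ℓ) ^ 2 / 2 := by
    rw [geometricLift, Real.norm_eq_abs, abs_div, abs_pow, abs_two]
    gcongr
  refine (norm_sub_le _ _).trans ?_
  rw [norm_neg, norm_smul, norm_smul, Real.norm_eq_abs (X v - X u)]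
  calc _ ≤ (A * ℓ) * (M * (D * ℓ) ^ 2 + M * (G * ℓ ^ 2))
        + ((A * ℓ) ^ 2 / 2) * (2 * M ^ 2 * (D * ℓ)) := by
        refine add_le_add (mul_le_mul hXuv ((norm_add_le _ _).trans (add_le_add h1 h2))
          (norm_nonneg _) (by positivity)) (mul_le_mul h4 h3 (norm_nonneg _) (by positivity))
    _ = _ := by ring

/-- Uniqueness for the rough equation: by the sewing estimate, the increments of a solution agree
with the second order germ up to order `3 β > 1`, and so does the flow by Taylor's formula. -/
theorem IsFlow.eqOn_of_isRDESolution {f : E → E} {ψ : ℝ → E → E} {M : NNReal} (hψ : IsFlow f ψ)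
    (hf : IsBoundedField M f) {X : ℝ → ℝ} {z : ℝ → E} {x₀ : E} {T : ℝ}
    (hz : IsRDESolution T f x₀ X (geometricLift X) z) :
    EqOn z (fun t => ψ (X t - X 0) x₀) (Icc 0 T) := by
  obtain ⟨β, hβ, -, hR, hzH, ⟨G, hG⟩, hI⟩ := hz
  obtain ⟨A, hA0, hA⟩ := hR.holder_first.exists_nonneg
  obtain ⟨D, hD0, hD⟩ := hzH.exists_nonneg
  intro t ht
  have h0T : (0 : ℝ) ∈ Icc 0 T := ⟨le_rfl, ht.1.trans ht.2⟩
  have hz0 : z 0 = x₀ := sub_eq_zero.1 (hI 0 h0T).eq_zero_of_self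
  have hθ : 1 < 3 * β := by linarith
  have hrp : ∀ {x y : ℝ}, 0 ≤ x → x ≤ y → x ^ β ≤ y ^ β := fun hx hxy =>
    Real.rpow_le_rpow hx hxy (by linarith)
  set K : ℝ := A * (M * D ^ 2 + M * |G|) + A ^ 2 * M ^ 2 * D with hK
  have hloc : ∀ s u, 0 ≤ s → s ≤ u → u ≤ t →
      ‖z u - z s - ((X u - X s) • f (z s) + geometricLift X s u • fderiv ℝ f (z s) (f (z s)))‖
        ≤ K * (1 - 2 ^ (1 - 3 * β))⁻¹ * (u - s) ^ (3 * β) := by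
    intro s u hs hsu hut
    have hsT : s ∈ Icc 0 T := ⟨hs, (hsu.trans hut).trans ht.2⟩
    have huT : u ∈ Icc 0 T := ⟨hs.trans hsu, hut.trans ht.2⟩
    have hsub : IsPartitionLimit (fun r s => (X s - X r) • f (z r)
        + geometricLift X r s • fderiv ℝ f (z r) (f (z r))) s u (z u - z s) := by
      simpa using (hI s hsT).sub hs (hI u huT)
    refine hsub.norm_sub_le hsu hθ fun r v w hr hrv hvw hwu => ?_
    have hrT : r ∈ Icc 0 T := ⟨hs.trans hr, ((hrv.trans hvw).trans hwu).trans huT.2⟩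
    have hvT : v ∈ Icc 0 T := ⟨hrT.1.trans hrv, (hvw.trans hwu).trans huT.2⟩
    have hwT : w ∈ Icc 0 T := ⟨hvT.1.trans hvw, hwu.trans huT.2⟩
    have h0 : 0 ≤ w - r := by linarith
    have hvr : |v - r| ^ β ≤ (w - r) ^ β :=
      hrp (abs_nonneg _) (by rw [abs_of_nonneg (by linarith)]; linarith)
    have hwv : |w - v| ^ β ≤ (w - r) ^ β :=
      hrp (abs_nonneg _) (by rw [abs_of_nonneg (by linarith)]; linarith)
    have := hf.norm_rough_defect_le (X := X) (z := z) (r := r) (u := v) (v := w)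
      (ℓ := (w - r) ^ β) (A := A) (D := D) (G := |G|) hA0 (by positivity)
      ((hA v hvT w hwT).trans (by gcongr)) ((hD r hrT v hvT).trans (by gcongr))
      ((hG r hrT v hvT).trans (by
        rw [show (2 : ℝ) * β = (2 : ℕ) * β by norm_num, ← rpow_pow_eq_rpow_mul (abs_nonneg _)]
        gcongr
        exact le_abs_self G))
    rwa [rpow_pow_eq_rpow_mul h0] at this
  have := hψ.eq_of_norm_sub_le hf.lipschitz (X := X) (z := z) (t := t) (R := A * t ^ β)
    (C := K * (1 - 2 ^ (1 - 3 * β))⁻¹ + 2 * M ^ 3 * A ^ 3) ht.1 hθ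
    (fun s u hs hsu hut => by
      refine (hA s ⟨hs, (hsu.trans hut).trans ht.2⟩ u ⟨hs.trans hsu, hut.trans ht.2⟩).trans ?_
      gcongr
      rw [abs_of_nonneg (by linarith)]
      linarith)
    (fun s u hs hsu hut => by
      have h0 : 0 ≤ u - s := by linarith
      have hT := hψ.norm_sub_taylor_two_le hf (X u - X s) (z s)
      have hXp : |X u - X s| ^ 3 ≤ A ^ 3 * (u - s) ^ (3 * β) := by
        have := hA s ⟨hs, (hsu.trans hut).trans ht.2⟩ u ⟨hs.trans hsu, hut.trans ht.2⟩
        rw [Real.norm_eq_abs, abs_of_nonneg h0] at this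
        have h3 := rpow_pow_eq_rpow_mul (β := β) h0 3
        push_cast at h3
        rw [← h3, ← mul_pow]
        gcongr
      have hl := hloc s u hs hsu hut
      have hid : z u - ψ (X u - X s) (z s)
          = (z u - z s - ((X u - X s) • f (z s)
              + geometricLift X s u • fderiv ℝ f (z s) (f (z s))))
            - (ψ (X u - X s) (z s) - z s - (X u - X s) • f (z s)
              - ((X u - X s) ^ 2 / 2) • fderiv ℝ f (z s) (f (z s))) := by
        simp only [geometricLift]; abel
      rw [hid]
      refine (_root_.norm_sub_le _ _).trans ((add_le_add hl hT).trans ?_)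
      have := mul_le_mul_of_nonneg_left hXp (show (0 : ℝ) ≤ 2 * M ^ 3 by positivity)
      linarith)
  rw [this, hz0]

theorem IsFlow.isRDESolution {f : E → E} {ψ : ℝ → E → E} {M : NNReal} (hψ : IsFlow f ψ)
    (hf : IsBoundedField M f) {X : ℝ → ℝ} {x₀ : E} {T β : ℝ} (hβ : 1 / 3 < β) (hβ2 : β ≤ 1 / 2)
    (hX : IsHolderPath β T X) (hX0 : X 0 = 0) :
    IsRDESolution T f x₀ X (geometricLift X) (fun t => ψ (X t) x₀) := by
  obtain ⟨A, hA0, hA⟩ := hX.exists_nonneg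
  have hpow : ∀ s ∈ Icc 0 T, ∀ t ∈ Icc 0 T, ∀ n : ℕ,
      |X t - X s| ^ n ≤ A ^ n * |t - s| ^ (n * β) := by
    intro s hs t ht n
    rw [← rpow_pow_eq_rpow_mul (abs_nonneg _), ← mul_pow]
    have := hA s hs t ht
    rw [Real.norm_eq_abs] at this
    gcongr
  have hflow : ∀ s t, ψ (X t) x₀ = ψ (X t - X s) (ψ (X s) x₀) := fun s t => by
    rw [← hψ.add hf.lipschitz, sub_add_cancel]
  refine ⟨β, hβ, hβ2, ⟨hX, ⟨A ^ 2, fun s hs t ht => ?_⟩, fun s _ u _ t _ => ?_⟩,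
    ⟨M * A, fun s hs t ht => ?_⟩, ⟨M ^ 2 * A ^ 2, fun s hs t ht => ?_⟩, fun t ht => ?_⟩
  · have := hpow s hs t ht 2
    rw [geometricLift, abs_div, abs_pow, abs_two]
    push_cast at this
    linarith [show 0 ≤ |X t - X s| ^ 2 by positivity]
  · simp only [geometricLift]; ring
  · calc _ ≤ M * |X t - X s| := hψ.norm_sub_le hf.norm_le _ _ _
      _ ≤ M * (A * |t - s| ^ β) := by gcongr; exact hA s hs t ht
      _ = _ := by ring
  · have h1 := hψ.norm_sub_taylor_one_le hf (X t - X s) (ψ (X s) x₀)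
    rw [← hflow] at h1
    have := hpow s hs t ht 2
    push_cast at this
    calc _ ≤ _ := h1
      _ ≤ M ^ 2 * (A ^ 2 * |t - s| ^ (2 * β)) := by gcongr
      _ = _ := by ring
  · have h := isPartitionLimit_of_norm_sub_le (w := fun t => ψ (X t) x₀) (a := 0)
      (b := t) (θ := 3 * β)
      (C := 2 * M ^ 3 * A ^ 3) (Ξ := fun r s => (X s - X r) • f (ψ (X r) x₀)
        + geometricLift X r s • fderiv ℝ f (ψ (X r) x₀) (f (ψ (X r) x₀))) (by linarith)
      (fun s u hs hsu hut => by
        have h1 := hψ.norm_sub_taylor_two_le hf (X u - X s) (ψ (X s) x₀)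
        rw [← hflow, sub_sub] at h1
        have := hpow s ⟨hs, (hsu.trans hut).trans ht.2⟩ u ⟨hs.trans hsu, hut.trans ht.2⟩ 3
        rw [abs_of_nonneg (show 0 ≤ u - s by linarith)] at this
        push_cast at this
        calc _ ≤ _ := h1
          _ ≤ 2 * M ^ 3 * (A ^ 3 * (u - s) ^ (3 * β)) := by gcongr
          _ = _ := by ring)
    simpa [hX0, hψ.zero] using h

/-- Uniqueness for the Young equation: as for the rough equation, with first order germs and the
exponent `2 β > 1`. -/
theorem IsFlow.eqOn_of_isYoungSolution {f : E → E} {ψ : ℝ → E → E} {M : NNReal} (hψ : IsFlow f ψ)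
    (hf : IsBoundedField M f) {X : ℝ → ℝ} {z : ℝ → E} {x₀ : E} {T : ℝ}
    (hz : IsYoungSolution T f x₀ X z) :
    EqOn z (fun t => ψ (X t - X 0) x₀) (Icc 0 T) := by
  obtain ⟨β, hβ, -, hXH, hzH, hI⟩ := hz
  obtain ⟨A, hA0, hA⟩ := hXH.exists_nonneg
  obtain ⟨D, hD0, hD⟩ := hzH.exists_nonneg
  intro t ht
  have h0T : (0 : ℝ) ∈ Icc 0 T := ⟨le_rfl, ht.1.trans ht.2⟩
  have hz0 : z 0 = x₀ := sub_eq_zero.1 (hI 0 h0T).eq_zero_of_self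
  have hθ : 1 < 2 * β := by linarith
  have hrp : ∀ {x y : ℝ}, 0 ≤ x → x ≤ y → x ^ β ≤ y ^ β := fun hx hxy =>
    Real.rpow_le_rpow hx hxy (by linarith)
  have hsq : ∀ {x : ℝ}, 0 ≤ x → x ^ β * x ^ β = x ^ (2 * β) := fun hx => by
    rw [← sq, rpow_pow_eq_rpow_mul hx]; norm_num
  have hloc : ∀ s u, 0 ≤ s → s ≤ u → u ≤ t → ‖z u - z s - (X u - X s) • f (z s)‖
      ≤ A * M * D * (1 - 2 ^ (1 - 2 * β))⁻¹ * (u - s) ^ (2 * β) := by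
    intro s u hs hsu hut
    have hsT : s ∈ Icc 0 T := ⟨hs, (hsu.trans hut).trans ht.2⟩
    have huT : u ∈ Icc 0 T := ⟨hs.trans hsu, hut.trans ht.2⟩
    have hsub : IsPartitionLimit (fun r s => (X s - X r) • f (z r)) s u (z u - z s) := by
      simpa using IsPartitionLimit.sub hs (hI s hsT) (hI u huT)
    refine hsub.norm_sub_le hsu hθ fun r v w hr hrv hvw hwu => ?_
    have hrT : r ∈ Icc 0 T := ⟨hs.trans hr, ((hrv.trans hvw).trans hwu).trans huT.2⟩
    have hvT : v ∈ Icc 0 T := ⟨hrT.1.trans hrv, (hvw.trans hwu).trans huT.2⟩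
    have hwT : w ∈ Icc 0 T := ⟨hvT.1.trans hvw, hwu.trans huT.2⟩
    have hvr : |v - r| ^ β ≤ (w - r) ^ β :=
      hrp (abs_nonneg _) (by rw [abs_of_nonneg (by linarith)]; linarith)
    have hwv : |w - v| ^ β ≤ (w - r) ^ β :=
      hrp (abs_nonneg _) (by rw [abs_of_nonneg (by linarith)]; linarith)
    have hid : (X w - X r) • f (z r) - (X v - X r) • f (z r) - (X w - X v) • f (z v)
        = -((X w - X v) • (f (z v) - f (z r))) := by module
    rw [hid, norm_neg, norm_smul]
    have h1 : ‖f (z v) - f (z r)‖ ≤ M * (D * (w - r) ^ β) := by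
      refine (hf.lipschitz.norm_sub_le _ _).trans ?_
      gcongr
      exact (hD r hrT v hvT).trans (by gcongr)
    have h0 : 0 ≤ w - r := by linarith
    calc _ ≤ (A * (w - r) ^ β) * (M * (D * (w - r) ^ β)) :=
          mul_le_mul ((hA v hvT w hwT).trans (by gcongr)) h1 (norm_nonneg _) (by positivity)
      _ = A * M * D * ((w - r) ^ β * (w - r) ^ β) := by ring
      _ = _ := by rw [hsq (by linarith)]
  have := hψ.eq_of_norm_sub_le hf.lipschitz (X := X) (z := z) (t := t) (R := A * t ^ β)
    (C := A * M * D * (1 - 2 ^ (1 - 2 * β))⁻¹ + M ^ 2 * A ^ 2) ht.1 hθ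
    (fun s u hs hsu hut => by
      refine (hA s ⟨hs, (hsu.trans hut).trans ht.2⟩ u ⟨hs.trans hsu, hut.trans ht.2⟩).trans ?_
      gcongr
      rw [abs_of_nonneg (by linarith)]
      linarith)
    (fun s u hs hsu hut => by
      have h0 : 0 ≤ u - s := by linarith
      have hT := hψ.norm_sub_taylor_one_le hf (X u - X s) (z s)
      have hXp : |X u - X s| ^ 2 ≤ A ^ 2 * (u - s) ^ (2 * β) := by
        have := hA s ⟨hs, (hsu.trans hut).trans ht.2⟩ u ⟨hs.trans hsu, hut.trans ht.2⟩
        rw [Real.norm_eq_abs, abs_of_nonneg h0] at this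
        rw [← hsq h0, ← sq, ← mul_pow]
        gcongr
      have hid : z u - ψ (X u - X s) (z s)
          = (z u - z s - (X u - X s) • f (z s))
            - (ψ (X u - X s) (z s) - z s - (X u - X s) • f (z s)) := by abel
      rw [hid]
      refine (_root_.norm_sub_le _ _).trans ((add_le_add (hloc s u hs hsu hut) hT).trans ?_)
      rw [add_mul, mul_assoc ((M : ℝ) ^ 2)]
      gcongr)
  rw [this, hz0]

theorem IsFlow.isYoungSolution {f : E → E} {ψ : ℝ → E → E} {M : NNReal} (hψ : IsFlow f ψ)
    (hf : IsBoundedField M f) {X : ℝ → ℝ} {x₀ : E} {T β : ℝ} (hβ : 1 / 2 < β) (hβ1 : β < 1)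
    (hX : IsHolderPath β T X) (hX0 : X 0 = 0) :
    IsYoungSolution T f x₀ X (fun t => ψ (X t) x₀) := by
  obtain ⟨A, hA0, hA⟩ := hX.exists_nonneg
  have hflow : ∀ s t, ψ (X t) x₀ = ψ (X t - X s) (ψ (X s) x₀) := fun s t => by
    rw [← hψ.add hf.lipschitz, sub_add_cancel]
  refine ⟨β, hβ, hβ1, hX, ⟨M * A, fun s hs t ht => ?_⟩, fun t ht => ?_⟩
  · calc _ ≤ M * |X t - X s| := hψ.norm_sub_le hf.norm_le _ _ _
      _ ≤ M * (A * |t - s| ^ β) := by gcongr; exact hA s hs t ht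
      _ = _ := by ring
  · have h := isPartitionLimit_of_norm_sub_le (w := fun t => ψ (X t) x₀) (a := 0)
      (b := t) (θ := 2 * β)
      (C := M ^ 2 * A ^ 2) (Ξ := fun r s => (X s - X r) • f (ψ (X r) x₀)) (by linarith)
      (fun s u hs hsu hut => by
        have h1 := hψ.norm_sub_taylor_one_le hf (X u - X s) (ψ (X s) x₀)
        rw [← hflow] at h1
        have h0 : 0 ≤ u - s := by linarith
        have := hA s ⟨hs, (hsu.trans hut).trans ht.2⟩ u ⟨hs.trans hsu, hut.trans ht.2⟩
        rw [Real.norm_eq_abs, abs_of_nonneg h0] at this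
        have h3 := rpow_pow_eq_rpow_mul (β := β) h0 2
        push_cast at h3
        calc _ ≤ _ := h1
          _ ≤ M ^ 2 * (A * (u - s) ^ β) ^ 2 := by gcongr
          _ = _ := by rw [mul_pow, h3]; ring)
    simpa [hX0, hψ.zero, IsRSIntegral] using h

end RDE

/-! ### The fast fractional Ornstein–Uhlenbeck process along a fixed path -/

section FOU

/-- Integration by parts for a `C¹` integrand against a continuous integrator. -/
theorem isRSIntegral_of_hasDerivAt {u u' b : ℝ → ℝ} (hu : ∀ s, HasDerivAt u (u' s) s)
    (hu' : Continuous u') (hb : Continuous b) {a t : ℝ} (hat : a ≤ t) :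
    IsRSIntegral u b a t (u t * b t - u a * b a - ∫ s in a..t, u' s * b s) := by
  have hi : ∀ r s, IntervalIntegrable (fun v => u' v * b v) volume r s :=
    fun r s => (hu'.mul hb).intervalIntegrable r s
  have key := isPartitionLimit_of_forall_eps (Ξ := fun r s => (b s - b r) • u r)
    (w := fun s => u s * b s - ∫ v in a..s, u' v * b v) (a := a) (b := t) ?_
  · have : (u t * b t - ∫ v in a..t, u' v * b v) - (u a * b a - ∫ v in a..a, u' v * b v)
        = u t * b t - u a * b a - ∫ s in a..t, u' s * b s := by
      rw [intervalIntegral.integral_same]; ring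
    rw [← this]
    exact key
  · intro κ hκ
    obtain ⟨L, hL⟩ := isCompact_Icc.exists_bound_of_continuousOn (s := Icc a t) hu'.continuousOn
    have hL0 : 0 ≤ L := (norm_nonneg _).trans (hL a ⟨le_rfl, hat⟩)
    have huc : UniformContinuousOn b (Icc a t) :=
      isCompact_Icc.uniformContinuousOn_of_continuous hb.continuousOn
    rw [Metric.uniformContinuousOn_iff] at huc
    obtain ⟨δ, hδ, huc⟩ := huc (κ / (L + 1)) (by positivity)
    refine ⟨δ, hδ, fun s r hs hsr hr hd => ?_⟩
    have hftc : ∫ v in s..r, u' v = u r - u s :=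
      intervalIntegral.integral_eq_sub_of_hasDerivAt (fun v _ => hu v) (hu'.intervalIntegrable s r)
    have hid : u r * b r - (∫ v in a..r, u' v * b v) - (u s * b s - ∫ v in a..s, u' v * b v)
        - (b r - b s) • u s = ∫ v in s..r, u' v * (b r - b v) := by
      have h1 : ∫ v in s..r, u' v * (b r - b v) = (∫ v in s..r, u' v) * b r
          - ∫ v in s..r, u' v * b v := by
        rw [← intervalIntegral.integral_mul_const, ← intervalIntegral.integral_sub
          ((hu'.intervalIntegrable s r).mul_const _) (hi s r)]
        congr 1; ext v; ring
      rw [h1, hftc, ← intervalIntegral.integral_interval_sub_left (hi a r) (hi a s), smul_eq_mul]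
      ring
    rw [hid]
    have := intervalIntegral.norm_integral_le_of_norm_le_const (a := s) (b := r) (C := κ)
      (f := fun v => u' v * (b r - b v)) (fun v hv => by
        rw [uIoc_of_le hsr] at hv
        have hv' : v ∈ Icc a t := ⟨hs.trans hv.1.le, hv.2.trans hr⟩
        have h1 := huc r ⟨hs.trans hsr, hr⟩ v hv' (by
          rw [Real.dist_eq, abs_of_nonneg (by linarith [hv.2])]; linarith [hv.1])
        rw [Real.dist_eq] at h1
        rw [norm_mul]
        calc _ ≤ L * (κ / (L + 1)) := by
              gcongr
              · exact hL v hv'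
              · exact h1.le
          _ = κ * (L / (L + 1)) := by ring
          _ ≤ κ := mul_le_of_le_one_right hκ.le (by rw [div_le_one (by positivity)]; linarith))
    rwa [abs_of_nonneg (by linarith)] at this

/-- The path `b` grows at most subexponentially at `-∞`. -/
def IsSubexpAtBot (b : ℝ → ℝ) : Prop :=
  ∀ c > 0, ∃ K : ℝ, ∀ s ≤ 0, |b s| ≤ K * Real.exp (-(c * s))

/-- The exponential moving average `ε⁻¹ ∫_{-∞}^t exp (-(t - s) / ε) b_s ds` of the path `b`. -/
noncomputable def expAverage (ε : ℝ) (b : ℝ → ℝ) (t : ℝ) : ℝ :=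
  ε⁻¹ * Real.exp (-(t / ε)) * ∫ s in Iic t, Real.exp (s / ε) * b s

variable {b : ℝ → ℝ} {ε : ℝ}

theorem IsSubexpAtBot.abs_exp_mul_le (hg : IsSubexpAtBot b) (hε : 0 < ε) :
    ∃ K, ∀ s ≤ 0, |Real.exp (s / ε) * b s| ≤ K * Real.exp ((2 * ε)⁻¹ * s) := by
  obtain ⟨K, hK⟩ := hg (2 * ε)⁻¹ (by positivity)
  refine ⟨K, fun s hs => ?_⟩
  rw [abs_mul, Real.abs_exp]
  calc _ ≤ Real.exp (s / ε) * (K * Real.exp (-((2 * ε)⁻¹ * s))) := by gcongr; exact hK s hs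
    _ = K * (Real.exp (s / ε) * Real.exp (-((2 * ε)⁻¹ * s))) := by ring
    _ = _ := by rw [← Real.exp_add]; congr 2; field_simp; ring

theorem IsSubexpAtBot.integrableOn (hg : IsSubexpAtBot b) (hb : Continuous b) (hε : 0 < ε) (t : ℝ) :
    IntegrableOn (fun s => Real.exp (s / ε) * b s) (Iic t) := by
  have hc : Continuous fun s => Real.exp (s / ε) * b s := by fun_prop
  obtain ⟨K, hK⟩ := hg.abs_exp_mul_le hε
  have h0 : IntegrableOn (fun s => Real.exp (s / ε) * b s) (Iic 0) := by
    refine Integrable.mono' ((integrableOn_exp_mul_Iic (a := (2 * ε)⁻¹) (by positivity) 0).const_mul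
      K) hc.aestronglyMeasurable.restrict ?_
    filter_upwards [ae_restrict_mem measurableSet_Iic] with s hs using hK s hs
  refine (h0.union (hc.integrableOn_Icc (a := 0) (b := t))).mono_set fun s hs => ?_
  rcases le_total s 0 with h | h
  exacts [Or.inl h, Or.inr ⟨h, hs⟩]

theorem IsSubexpAtBot.tendsto (hg : IsSubexpAtBot b) (hε : 0 < ε) :
    Tendsto (fun s => Real.exp (s / ε) * b s) atBot (𝓝 0) := by
  obtain ⟨K, hK⟩ := hg.abs_exp_mul_le hε
  have h1 : Tendsto (fun s : ℝ => K * Real.exp ((2 * ε)⁻¹ * s)) atBot (𝓝 0) := by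
    simpa using (Real.tendsto_exp_atBot.comp
      (tendsto_id.const_mul_atBot (show 0 < (2 * ε)⁻¹ by positivity))).const_mul K
  refine squeeze_zero_norm' ?_ h1
  filter_upwards [eventually_le_atBot 0] with s hs using hK s hs

theorem hasDerivAt_expAverage (hg : IsSubexpAtBot b) (hb : Continuous b) (hε : 0 < ε) (t : ℝ) :
    HasDerivAt (expAverage ε b) (ε⁻¹ * (b t - expAverage ε b t)) t := by
  have hc : Continuous fun s => Real.exp (s / ε) * b s := by fun_prop
  have hF : HasDerivAt (fun t => ∫ s in Iic t, Real.exp (s / ε) * b s) (Real.exp (t / ε) * b t)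
      t := by
    have heq : (fun t => ∫ s in Iic t, Real.exp (s / ε) * b s)
        = fun t => (∫ s in Iic 0, Real.exp (s / ε) * b s) + ∫ s in (0 : ℝ)..t,
          Real.exp (s / ε) * b s := by
      ext t
      rw [← intervalIntegral.integral_Iic_sub_Iic (hg.integrableOn hb hε 0)
        (hg.integrableOn hb hε t)]
      ring
    rw [heq]
    exact (intervalIntegral.integral_hasDerivAt_right (hc.intervalIntegrable _ _)
      (hc.stronglyMeasurableAtFilter _ _) hc.continuousAt).const_add _
  have hE : HasDerivAt (fun t => ε⁻¹ * Real.exp (-(t / ε)))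
      (ε⁻¹ * (Real.exp (-(t / ε)) * (-(1 / ε)))) t :=
    (((hasDerivAt_id t).div_const ε).neg.exp).const_mul _
  refine (hE.mul hF).congr_deriv ?_
  have hexp : Real.exp (-(t / ε)) * Real.exp (t / ε) = 1 := by rw [← Real.exp_add]; simp
  calc _ = ε⁻¹ * ((Real.exp (-(t / ε)) * Real.exp (t / ε)) * b t - (ε⁻¹ * Real.exp (-(t / ε))
        * ∫ s in Iic t, Real.exp (s / ε) * b s)) := by rw [one_div]; ring
    _ = _ := by rw [hexp, one_mul]; rfl

theorem continuous_expAverage (hg : IsSubexpAtBot b) (hb : Continuous b) (hε : 0 < ε) :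
    Continuous (expAverage ε b) :=
  continuous_iff_continuousAt.2 fun t => (hasDerivAt_expAverage hg hb hε t).continuousAt

/-- Integrating by parts, the fast Ornstein–Uhlenbeck path is, up to scaling, the difference between
the driving path and its exponential moving average. -/
theorem isFastFOU_sub_expAverage (hg : IsSubexpAtBot b) (hb : Continuous b) (hε : 0 < ε)
    (H σ : ℝ) :
    IsFastFOU H σ ε b (fun t => σ / ε ^ H * (b t - expAverage ε b t)) := by
  intro t
  have hu : ∀ s, HasDerivAt (fun s => Real.exp (-(t - s) / ε))
      (ε⁻¹ * Real.exp (-(t - s) / ε)) s := fun s => by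
    have h1 : HasDerivAt (fun s => -(t - s) / ε) (1 / ε) s := by
      simpa using (((hasDerivAt_id s).const_sub t).neg.div_const ε)
    exact h1.exp.congr_deriv (by rw [one_div]; ring)
  have hsplit : ∀ s, Real.exp (-(t - s) / ε) = Real.exp (-(t / ε)) * Real.exp (s / ε) := fun s => by
    rw [← Real.exp_add]; congr 1; ring
  refine ⟨fun a => Real.exp (-(t - t) / ε) * b t - Real.exp (-(t - a) / ε) * b a
    - ∫ s in a..t, ε⁻¹ * Real.exp (-(t - s) / ε) * b s, fun a ha =>
      isRSIntegral_of_hasDerivAt hu (by fun_prop) hb ha, Tendsto.const_mul _ ?_⟩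
  refine Tendsto.sub ?_ ?_
  · have h1 := (hg.tendsto hε).const_mul (Real.exp (-(t / ε)))
    have h2 : (fun a => Real.exp (-(t - t) / ε) * b t - Real.exp (-(t - a) / ε) * b a)
        = fun a => b t - Real.exp (-(t / ε)) * (Real.exp (a / ε) * b a) := by
      ext a
      rw [hsplit a, sub_self, neg_zero, zero_div, Real.exp_zero]
      ring
    rw [h2]
    simpa using h1.const_sub (b t)
  · have h1 := intervalIntegral_tendsto_integral_Iic t (hg.integrableOn hb hε t) tendsto_id
    have h2 := h1.const_mul (ε⁻¹ * Real.exp (-(t / ε)))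
    refine h2.congr fun a => ?_
    rw [← intervalIntegral.integral_const_mul]
    congr 1
    ext s
    rw [hsplit]
    ring

/-- The law of a standard exponential random variable. -/
noncomputable def expLaw : Measure ℝ :=
  (volume.restrict (Ioi 0)).withDensity fun v => ENNReal.ofReal (Real.exp (-v))

instance isProbabilityMeasure_expLaw : IsProbabilityMeasure expLaw := by
  refine ⟨?_⟩
  rw [expLaw, withDensity_apply _ MeasurableSet.univ, Measure.restrict_univ,
    ← ofReal_integral_eq_lintegral_ofReal
    (by simpa [IntegrableOn] using exp_neg_integrableOn_Ioi 0 one_pos)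
    (ae_of_all _ fun v => (Real.exp_pos _).le), integral_exp_neg_Ioi_zero, ENNReal.ofReal_one]

theorem integral_expLaw (g : ℝ → ℝ) : ∫ v, g v ∂expLaw = ∫ v in Ioi 0, Real.exp (-v) * g v := by
  rw [expLaw, integral_withDensity_eq_integral_toReal_smul (by fun_prop) (by simp)]
  simp [ENNReal.toReal_ofReal, (Real.exp_pos _).le]

theorem expAverage_eq_integral_expLaw (b : ℝ → ℝ) (hε : 0 < ε) (t : ℝ) :
    expAverage ε b t = ∫ v, b (t - ε * v) ∂expLaw := by
  have hpre : (fun x : ℝ => t - x) ⁻¹' (Iio t) = Ioi 0 := by ext x; simp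
  have h1 := (Measure.measurePreserving_sub_left volume t).setIntegral_preimage_emb
    (Homeomorph.subLeft t).measurableEmbedding (fun s => Real.exp (s / ε) * b s) (Iio t)
  rw [hpre] at h1
  have h2 := integral_comp_mul_left_Ioi (fun x => Real.exp ((t - x) / ε) * b (t - x)) 0 hε
  rw [mul_zero, h1, smul_eq_mul] at h2
  rw [integral_expLaw, expAverage, integral_Iic_eq_integral_Iio, mul_right_comm, ← h2,
    ← integral_mul_const]
  refine setIntegral_congr_fun measurableSet_Ioi fun v _ => ?_
  have : Real.exp (-v) = Real.exp ((t - ε * v) / ε) * Real.exp (-(t / ε)) := by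
    rw [← Real.exp_add]; congr 1; field_simp; ring
  simp only [this]
  ring

theorem IsSubexpAtBot.integrable_expLaw (hg : IsSubexpAtBot b) (hb : Continuous b) (hε : 0 < ε)
    (t : ℝ) : Integrable (fun v => b (t - ε * v)) expLaw := by
  have hpre : (fun x : ℝ => t - x) ⁻¹' (Iic t) = Ici 0 := by ext x; simp
  have h1 := ((Measure.measurePreserving_sub_left volume t).integrableOn_comp_preimage
    (Homeomorph.subLeft t).measurableEmbedding).2 (hg.integrableOn hb hε t)
  rw [hpre] at h1
  have h2 := (integrableOn_Ioi_comp_mul_left_iff _ 0 hε).2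
    ((h1.mono_set Ioi_subset_Ici_self).mono_set (by rw [mul_zero]))
  rw [expLaw, integrable_withDensity_iff_integrable_smul' (by fun_prop) (by simp)]
  refine (h2.const_mul (Real.exp (-(t / ε)))).congr (ae_of_all _ fun v => ?_)
  have : Real.exp (-v) = Real.exp (-(t / ε)) * Real.exp ((t - ε * v) / ε) := by
    rw [← Real.exp_add]; congr 1; field_simp; ring
  simp only [Function.comp, ENNReal.toReal_ofReal (Real.exp_pos (-v)).le, smul_eq_mul]
  rw [this]
  ring

end FOU

/-! ### Hölder seminorms and the Kolmogorov continuity estimate -/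

section Holder

variable {E : Type*} [NormedAddCommGroup E]

/-- The `β`-Hölder seminorm of `u` on `[0, t]`, with values in `[0, ∞]`. -/
noncomputable def holderSemi (β t : ℝ) (u : ℝ → E) : ℝ≥0∞ :=
  ⨆ s ∈ Icc 0 t, ⨆ r ∈ Icc 0 t, ‖u s - u r‖ₑ / ENNReal.ofReal (|s - r| ^ β)

theorem holderNormOn_eq (β t : ℝ) (u : ℝ → E) :
    holderNormOn β t u = supNormOn t u + holderSemi β t u := rfl

theorem holderSemi_le {β t : ℝ} {u : ℝ → E} {K : ℝ≥0∞}
    (h : ∀ s ∈ Icc 0 t, ∀ r ∈ Icc 0 t, ‖u s - u r‖ₑ ≤ K * ENNReal.ofReal (|s - r| ^ β)) :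
    holderSemi β t u ≤ K :=
  iSup₂_le fun s hs => iSup₂_le fun r hr => ENNReal.div_le_of_le_mul (h s hs r hr)

theorem enorm_sub_le_holderSemi (β : ℝ) {t : ℝ} (u : ℝ → E) {s r : ℝ} (hs : s ∈ Icc 0 t)
    (hr : r ∈ Icc 0 t) : ‖u s - u r‖ₑ ≤ holderSemi β t u * ENNReal.ofReal (|s - r| ^ β) := by
  rcases eq_or_ne s r with rfl | hne
  · simp
  · have h0 : 0 < |s - r| ^ β := Real.rpow_pos_of_pos (abs_pos.2 (sub_ne_zero.2 hne)) _
    rw [← ENNReal.div_le_iff (by simpa using h0) ENNReal.ofReal_ne_top]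
    exact (le_iSup₂ (f := fun r (_ : r ∈ Icc 0 t) =>
      ‖u s - u r‖ₑ / ENNReal.ofReal (|s - r| ^ β)) r hr).trans
      (le_iSup₂ (f := fun s (_ : s ∈ Icc 0 t) => ⨆ r ∈ Icc 0 t,
      ‖u s - u r‖ₑ / ENNReal.ofReal (|s - r| ^ β)) s hs)

theorem holderSemi_mono {β t T : ℝ} (u : ℝ → E) (h : t ≤ T) :
    holderSemi β t u ≤ holderSemi β T u :=
  holderSemi_le fun _ hs _ hr => enorm_sub_le_holderSemi β u ⟨hs.1, hs.2.trans h⟩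
    ⟨hr.1, hr.2.trans h⟩

theorem isHolderPath_of_holderSemi_lt_top {β T : ℝ} {u : ℝ → E} (h : holderSemi β T u < ∞) :
    IsHolderPath β T u := by
  refine ⟨(holderSemi β T u).toReal, fun s hs t ht => ?_⟩
  have h1 := enorm_sub_le_holderSemi β u ht hs
  rw [← ofReal_norm, ← ENNReal.ofReal_toReal h.ne,
    ← ENNReal.ofReal_mul ENNReal.toReal_nonneg] at h1
  exact (ENNReal.ofReal_le_ofReal_iff (by positivity)).1 h1

/-- A continuous path with dyadic increments of order `2^{-nβ}` at level `n` is `β`-Hölder: chain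
along the dyadic approximations from below of the two points. -/
theorem norm_sub_le_of_dyadic {β : ℝ} (hβ : 0 < β) :
    ∃ C : ℝ, 0 < C ∧ ∀ (u : ℝ → E) (K : ℝ), Continuous u → 0 ≤ K →
      (∀ n k : ℕ, k < 2 ^ n →
        ‖u ((k + 1 : ℕ) / 2 ^ n) - u ((k : ℕ) / 2 ^ n)‖ ≤ K * ((2 : ℝ) ^ (-β)) ^ n) →
      ∀ s ∈ Icc (0 : ℝ) 1, ∀ r ∈ Icc (0 : ℝ) 1, ‖u s - u r‖ ≤ C * K * |s - r| ^ β := by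
  set ρ : ℝ := (2 : ℝ) ^ (-β) with hρ
  have hρ0 : 0 < ρ := by positivity
  have hρ1 : ρ < 1 := Real.rpow_lt_one_of_one_lt_of_neg (by norm_num) (by linarith)
  have h1ρ : 0 < 1 - ρ := by linarith
  refine ⟨(1 + 2 * (ρ / (1 - ρ))) / ρ, by positivity, fun u K hu hK hd => ?_⟩
  set π : ℕ → ℝ → ℝ := fun n s => (⌊2 ^ n * s⌋₊ : ℝ) / 2 ^ n with hπ
  have hstep : ∀ s ∈ Icc (0 : ℝ) 1, ∀ n,
      dist (u (π n s)) (u (π (n + 1) s)) ≤ K * ρ * ρ ^ n := by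
    intro s hs n
    set k := ⌊2 ^ n * s⌋₊ with hk
    have hs0 : 0 ≤ 2 ^ n * s := by have := hs.1; positivity
    have hk1 : (k : ℝ) ≤ 2 ^ n * s := Nat.floor_le hs0
    have hk2 : 2 ^ n * s < k + 1 := Nat.lt_floor_add_one _
    have hfl : ⌊2 ^ (n + 1) * s⌋₊ = 2 * k ∨ ⌊2 ^ (n + 1) * s⌋₊ = 2 * k + 1 := by
      have h1 : 2 * k ≤ ⌊2 ^ (n + 1) * s⌋₊ := Nat.le_floor (by push_cast; rw [pow_succ]; linarith)
      have h2 : ⌊2 ^ (n + 1) * s⌋₊ < 2 * k + 2 := by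
        rw [Nat.floor_lt (by rw [pow_succ]; linarith)]
        push_cast; rw [pow_succ]; linarith
      omega
    have heq : π n s = ((2 * k : ℕ) : ℝ) / 2 ^ (n + 1) := by
      simp only [hπ, ← hk]; push_cast; rw [pow_succ]; field_simp
    rw [dist_comm, dist_eq_norm, heq]
    rcases hfl with h | h
    · simp only [hπ, h, sub_self, norm_zero]; positivity
    · simp only [hπ, h]
      have hlt : 2 * k < 2 ^ (n + 1) := by
        have h3 : ((2 * k + 1 : ℕ) : ℝ) ≤ 2 ^ (n + 1) * s :=
          h ▸ Nat.floor_le (by rw [pow_succ]; linarith)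
        have h4 : (2 : ℝ) ^ (n + 1) * s ≤ 2 ^ (n + 1) :=
          mul_le_of_le_one_right (by positivity) hs.2
        have : 2 * k + 1 ≤ 2 ^ (n + 1) := by exact_mod_cast h3.trans h4
        omega
      calc _ ≤ K * ρ ^ (n + 1) := hd (n + 1) (2 * k) hlt
        _ = _ := by ring
  have hlim : ∀ s ∈ Icc (0 : ℝ) 1, Tendsto (fun n => u (π n s)) atTop (𝓝 (u s)) := by
    intro s hs
    refine (hu.tendsto s).comp ?_
    have h2 : Tendsto (fun n : ℕ => s - (1 / 2 : ℝ) ^ n) atTop (𝓝 s) := by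
      simpa using (tendsto_pow_atTop_nhds_zero_of_lt_one (r := (1 / 2 : ℝ)) (by norm_num)
        (by norm_num)).const_sub s
    refine tendsto_of_tendsto_of_tendsto_of_le_of_le h2 tendsto_const_nhds (fun n => ?_) fun n => ?_
    · have := (Nat.lt_floor_add_one ((2 : ℝ) ^ n * s)).le
      simp only [hπ]
      rw [le_div_iff₀ (by positivity), sub_mul, div_pow, one_pow,
        one_div_mul_cancel (by positivity)]
      linarith
    · have := Nat.floor_le (a := (2 : ℝ) ^ n * s) (by have := hs.1; positivity)
      simp only [hπ]
      rw [div_le_iff₀ (by positivity)]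
      linarith
  have happ : ∀ s ∈ Icc (0 : ℝ) 1, ∀ n, dist (u (π n s)) (u s) ≤ K * ρ * ρ ^ n / (1 - ρ) :=
    fun s hs n => dist_le_of_le_geometric_of_tendsto _ _ hρ1 (hstep s hs) (hlim s hs) n
  have hlt : ∀ s ∈ Icc (0 : ℝ) 1, ∀ r ∈ Icc (0 : ℝ) 1, s < r →
      ‖u s - u r‖ ≤ (1 + 2 * (ρ / (1 - ρ))) / ρ * K * |s - r| ^ β := by
    intro s hs r hr hsr
    have hpos : 0 < r - s := by linarith
    obtain ⟨n, hn1, hn2⟩ := exists_nat_pow_near_of_lt_one (x := r - s) (y := 1 / 2) hpos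
      (by linarith [hs.1, hr.2]) (by norm_num) (by norm_num)
    have hmid : dist (u (π n s)) (u (π n r)) ≤ K * ρ ^ n := by
      set k := ⌊2 ^ n * s⌋₊ with hk
      have hs0 : 0 ≤ 2 ^ n * s := by have := hs.1; positivity
      have hr0 : 0 ≤ 2 ^ n * r := by have := hr.1; positivity
      have hk2 : 2 ^ n * s < k + 1 := Nat.lt_floor_add_one _
      have hrs : (2 : ℝ) ^ n * (r - s) ≤ 1 := by
        calc (2 : ℝ) ^ n * (r - s) ≤ 2 ^ n * (1 / 2) ^ n := by gcongr
          _ = 1 := by rw [← mul_pow]; norm_num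
      have hfl : ⌊2 ^ n * r⌋₊ = k ∨ ⌊2 ^ n * r⌋₊ = k + 1 := by
        have h1 : k ≤ ⌊2 ^ n * r⌋₊ := Nat.floor_le_floor (by gcongr)
        have h2 : ⌊2 ^ n * r⌋₊ < k + 2 := by
          rw [Nat.floor_lt hr0]
          push_cast; linarith
        omega
      rw [dist_comm, dist_eq_norm]
      simp only [hπ, ← hk]
      rcases hfl with h | h
      · rw [h, sub_self, norm_zero]; positivity
      · rw [h]
        refine hd n k ?_
        have h3 : ((k + 1 : ℕ) : ℝ) ≤ 2 ^ n * r := h ▸ Nat.floor_le hr0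
        have h4 : (2 : ℝ) ^ n * r ≤ 2 ^ n := mul_le_of_le_one_right (by positivity) hr.2
        have : k + 1 ≤ 2 ^ n := by exact_mod_cast h3.trans h4
        omega
    have hpow : ρ ^ n ≤ |s - r| ^ β / ρ := by
      have h2 : ρ = (1 / 2 : ℝ) ^ β := by
        rw [hρ, one_div, Real.inv_rpow (by norm_num), Real.rpow_neg (by norm_num)]
      rw [le_div_iff₀ hρ0, ← pow_succ, abs_sub_comm, abs_of_pos hpos, h2,
        Real.rpow_pow_comm (by norm_num)]
      gcongr
    rw [← dist_eq_norm]
    calc dist (u s) (u r) ≤ dist (u s) (u (π n s)) + dist (u (π n s)) (u (π n r))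
          + dist (u (π n r)) (u r) := dist_triangle4 _ _ _ _
      _ ≤ K * ρ * ρ ^ n / (1 - ρ) + K * ρ ^ n + K * ρ * ρ ^ n / (1 - ρ) := by
          gcongr
          · rw [dist_comm]; exact happ s hs n
          · exact happ r hr n
      _ = (1 + 2 * (ρ / (1 - ρ))) * K * ρ ^ n := by ring
      _ ≤ (1 + 2 * (ρ / (1 - ρ))) * K * (|s - r| ^ β / ρ) := by gcongr
      _ = _ := by ring
  intro s hs r hr
  rcases lt_trichotomy s r with h | rfl | h
  · exact hlt s hs r hr h
  · simp only [sub_self, norm_zero]; positivity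
  · rw [norm_sub_rev, abs_sub_comm]; exact hlt r hr s hs h

theorem measurable_supNormOn {Ω : Type*} [MeasurableSpace Ω] {Z : ℝ → Ω → E} (t : ℝ)
    (hm : ∀ s, Measurable fun ω => ‖Z s ω‖ₑ) (hc : ∀ ω, Continuous fun s => Z s ω) :
    Measurable fun ω => supNormOn t (fun s => Z s ω) := by
  simp_rw [supNormOn, iSup_subtype']
  have h := measurable_iSup_of_lowerSemicontinuous (f := fun (s : Icc (0 : ℝ) t) ω => ‖Z s ω‖ₑ)
    (fun s => hm s) fun ω => ((hc ω).enorm.comp continuous_subtype_val).lowerSemicontinuous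
  convert h using 1
  ext ω
  rw [iSup_apply]

/-- The quotients are lower semicontinuous in the pair of times (on the diagonal they vanish), so
the supremum may be taken over a countable dense set. -/
theorem measurable_holderSemi {Ω : Type*} [MeasurableSpace Ω] {Z : ℝ → Ω → E} (β t : ℝ)
    (hm : ∀ s r, Measurable fun ω => ‖Z s ω - Z r ω‖ₑ) (hc : ∀ ω, Continuous fun s => Z s ω) :
    Measurable fun ω => holderSemi β t (fun s => Z s ω) := by
  have heq : ∀ ω, holderSemi β t (fun s => Z s ω) = ⨆ p : Icc (0 : ℝ) t × Icc (0 : ℝ) t,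
      ‖Z p.1 ω - Z p.2 ω‖ₑ / ENNReal.ofReal (|(p.1 : ℝ) - p.2| ^ β) := fun ω => by
    rw [iSup_prod]
    simp only [holderSemi, iSup_subtype']
  suffices h : Measurable (⨆ p : Icc (0 : ℝ) t × Icc (0 : ℝ) t, fun ω =>
      ‖Z p.1 ω - Z p.2 ω‖ₑ / ENNReal.ofReal (|(p.1 : ℝ) - p.2| ^ β)) by
    convert h using 1
    ext ω
    rw [heq, iSup_apply]
  refine measurable_iSup_of_lowerSemicontinuous (fun p => (hm _ _).div_const _) fun ω p c hc' => ?_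
  have hne : (p.1 : ℝ) ≠ p.2 := by
    intro h
    simp [h] at hc'
  have h0 : 0 < |(p.1 : ℝ) - p.2| := abs_pos.2 (sub_ne_zero.2 hne)
  refine Tendsto.eventually_const_lt hc' (ENNReal.Tendsto.div ?_ ?_ ?_ ?_)
  · exact Continuous.tendsto (by have := hc ω; fun_prop) p
  · right
    simpa using Real.rpow_pos_of_pos h0 β
  · refine (ENNReal.continuous_ofReal.tendsto _).comp ?_
    exact ((Real.continuousAt_rpow_const _ _ (Or.inl h0.ne')).tendsto).comp
      (Continuous.tendsto (f := fun q : Icc (0 : ℝ) t × Icc (0 : ℝ) t => |(q.1 : ℝ) - q.2|)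
        (by fun_prop) p)
  · left
    exact ENNReal.ofReal_ne_top

/-- **Kolmogorov's continuity estimate**, with the dependence on the length `L` of the interval. -/
theorem lintegral_holderSemi_rpow_le {Ω : Type*} [MeasurableSpace Ω] (P : Measure Ω) {β γ q : ℝ}
    (hβ : 0 < β) (hq : 0 < q) (hβγ : 1 + β * q < γ * q) :
    ∃ C : NNReal, ∀ (Z : ℝ → Ω → E) (L : ℝ) (A : ℝ≥0∞), 0 ≤ L →
      (∀ ω, Continuous fun s => Z s ω) → (∀ s r, Measurable fun ω => ‖Z s ω - Z r ω‖ₑ) →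
      (∀ s ∈ Icc 0 L, ∀ r ∈ Icc 0 L,
        ∫⁻ ω, ‖Z s ω - Z r ω‖ₑ ^ q ∂P ≤ A * ENNReal.ofReal (|s - r| ^ (γ * q))) →
      ∫⁻ ω, holderSemi β L (fun s => Z s ω) ^ q ∂P
        ≤ C * A * ENNReal.ofReal (L ^ ((γ - β) * q)) := by
  obtain ⟨c, hc0, hc⟩ := norm_sub_le_of_dyadic (E := E) hβ
  set τ : ℝ := 2 ^ (1 + β * q - γ * q) with hτ
  have hτ0 : 0 < τ := by positivity
  have hτ1 : τ < 1 := Real.rpow_lt_one_of_one_lt_of_neg (by norm_num) (by linarith)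
  have hG : ∑' n : ℕ, ENNReal.ofReal τ ^ n ≠ ⊤ := by
    rw [ENNReal.tsum_geometric]
    simpa [tsub_eq_zero_iff_le] using hτ1
  refine ⟨(ENNReal.ofReal (c ^ q) * ∑' n : ℕ, ENNReal.ofReal τ ^ n).toNNReal,
    fun Z L A hL0 hZc hZm hZ => ?_⟩
  rw [ENNReal.coe_toNNReal (ENNReal.mul_ne_top ENNReal.ofReal_ne_top hG)]
  rcases hL0.eq_or_lt with rfl | hL
  · have h0 : ∀ ω, holderSemi β 0 (fun s => Z s ω) = 0 := fun ω => by
      refine le_antisymm (holderSemi_le fun s hs r hr => ?_) bot_le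
      have : s = r := by linarith [hs.1, hs.2, hr.1, hr.2]
      simp [this]
    simp [h0, hq]
  -- The sum over all dyadic increments dominates the `q`-th power of the seminorm.
  set I : ℕ → ℕ → Ω → ℝ≥0∞ := fun n k ω =>
    ‖Z (L * ((k + 1 : ℕ) / 2 ^ n)) ω - Z (L * ((k : ℕ) / 2 ^ n)) ω‖ₑ ^ q
      * ENNReal.ofReal (2 ^ (n * (β * q))) with hI
  set S : Ω → ℝ≥0∞ := fun ω => ∑' n, ∑ k ∈ Finset.range (2 ^ n), I n k ω with hS
  have hpath : ∀ ω, holderSemi β L (fun s => Z s ω) ^ q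
      ≤ ENNReal.ofReal (c ^ q) * ENNReal.ofReal (L ^ (-β * q)) * S ω := by
    intro ω
    by_cases hSt : S ω = ⊤
    · rw [hSt, ENNReal.mul_top]
      · exact le_top
      · have h1 : 0 < c ^ q := by positivity
        have h2 : 0 < L ^ (-β * q) := by positivity
        simp only [ne_eq, mul_eq_zero, ENNReal.ofReal_eq_zero, not_or, not_le]
        exact ⟨h1, h2⟩
    set K : ℝ := (S ω).toReal ^ q⁻¹ with hK
    have hK0 : 0 ≤ K := by positivity
    have hKS : ENNReal.ofReal K ^ q = S ω := by
      rw [hK, ENNReal.ofReal_rpow_of_nonneg hK0 hq.le, ← Real.rpow_mul ENNReal.toReal_nonneg,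
        inv_mul_cancel₀ hq.ne', Real.rpow_one, ENNReal.ofReal_toReal hSt]
    have hinc : ∀ n k : ℕ, k < 2 ^ n →
        ‖Z (L * ((k + 1 : ℕ) / 2 ^ n)) ω - Z (L * ((k : ℕ) / 2 ^ n)) ω‖
          ≤ K * ((2 : ℝ) ^ (-β)) ^ n := by
      intro n k hk
      have h1 : I n k ω ≤ S ω :=
        (Finset.single_le_sum (f := fun k => I n k ω) (fun _ _ => bot_le)
          (Finset.mem_range.2 hk)).trans (ENNReal.le_tsum n)
      rw [← hKS] at h1
      set x := ‖Z (L * ((k + 1 : ℕ) / 2 ^ n)) ω - Z (L * ((k : ℕ) / 2 ^ n)) ω‖ with hx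
      have h2 : I n k ω = ENNReal.ofReal ((x * 2 ^ (n * β)) ^ q) := by
        simp only [hI]
        rw [← ofReal_norm, ← hx, ENNReal.ofReal_rpow_of_nonneg (norm_nonneg _) hq.le,
          ← ENNReal.ofReal_mul (by positivity), Real.mul_rpow (norm_nonneg _) (by positivity),
          ← Real.rpow_mul (by norm_num), mul_assoc]
      rw [h2, ENNReal.ofReal_rpow_of_nonneg hK0 hq.le,
        ENNReal.ofReal_le_ofReal_iff (by positivity),
        Real.rpow_le_rpow_iff (by positivity) hK0 hq] at h1
      rw [← Real.rpow_natCast, ← Real.rpow_mul (by norm_num), neg_mul, mul_comm β,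
        Real.rpow_neg (by norm_num), ← div_eq_mul_inv, le_div_iff₀ (by positivity)]
      exact h1
    have hhol : holderSemi β L (fun s => Z s ω) ≤ ENNReal.ofReal (c * K * L ^ (-β)) := by
      refine holderSemi_le fun s hs r hr => ?_
      have h1 := hc (fun x => Z (L * x) ω) K ((hZc ω).comp (continuous_const_mul L)) hK0 hinc
        (s / L) ⟨div_nonneg hs.1 hL.le, (div_le_one hL).2 hs.2⟩
        (r / L) ⟨div_nonneg hr.1 hL.le, (div_le_one hL).2 hr.2⟩
      rw [← ENNReal.ofReal_mul (by positivity), ← ofReal_norm]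
      refine ENNReal.ofReal_le_ofReal ?_
      simp only [mul_div_cancel₀ _ hL.ne'] at h1
      rw [← sub_div, abs_div, abs_of_pos hL, Real.div_rpow (abs_nonneg _) hL.le] at h1
      rw [Real.rpow_neg hL.le]
      calc _ ≤ _ := h1
        _ = _ := by ring
    calc _ ≤ ENNReal.ofReal (c * K * L ^ (-β)) ^ q := by gcongr
      _ = ENNReal.ofReal (c ^ q) * ENNReal.ofReal (L ^ (-β * q)) * ENNReal.ofReal K ^ q := by
        rw [ENNReal.ofReal_rpow_of_nonneg (by positivity) hq.le, ENNReal.ofReal_rpow_of_nonneg hK0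
          hq.le, ← ENNReal.ofReal_mul (by positivity), ← ENNReal.ofReal_mul (by positivity),
          Real.mul_rpow (by positivity) (by positivity), Real.mul_rpow hc0.le hK0,
          ← Real.rpow_mul hL.le]
        congr 1; ring
      _ = _ := by rw [hKS]
  have hIm : ∀ n k, Measurable (I n k) := fun n k => ((hZm _ _).pow_const q).mul_const _
  have hSm : Measurable S := Measurable.tsum fun n =>
    Finset.measurable_fun_sum _ fun k _ => hIm n k
  have hES : ∫⁻ ω, S ω ∂P ≤ A * ENNReal.ofReal (L ^ (γ * q)) * ∑' n : ℕ, ENNReal.ofReal τ ^ n := by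
    simp only [hS]
    rw [lintegral_tsum fun n => (Finset.measurable_fun_sum _ fun k _ => hIm n k).aemeasurable,
      ← ENNReal.tsum_mul_left]
    refine ENNReal.tsum_le_tsum fun n => ?_
    rw [lintegral_finsetSum _ fun k _ => hIm n k]
    have hpt : ∀ k < 2 ^ n, ∀ m : ℕ, m = k ∨ m = k + 1 → L * ((m : ℕ) / 2 ^ n : ℝ) ∈ Icc 0 L := by
      intro k hk m hm
      refine ⟨by positivity, mul_le_of_le_one_right hL.le ?_⟩
      rw [div_le_one (by positivity)]
      exact_mod_cast (show m ≤ 2 ^ n by omega)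
    calc _ ≤ ∑ k ∈ Finset.range (2 ^ n), A * ENNReal.ofReal ((L / 2 ^ n) ^ (γ * q))
          * ENNReal.ofReal (2 ^ (n * (β * q))) := by
          refine Finset.sum_le_sum fun k hk => ?_
          have hk := Finset.mem_range.1 hk
          simp only [hI]
          rw [lintegral_mul_const _ ((hZm _ _).pow_const q)]
          gcongr
          have h1 := hZ _ (hpt k hk (k + 1) (Or.inr rfl)) _ (hpt k hk k (Or.inl rfl))
          have h2 : |L * ((k + 1 : ℕ) / 2 ^ n : ℝ) - L * ((k : ℕ) / 2 ^ n)| = L / 2 ^ n := by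
            rw [← abs_of_pos (show 0 < L / 2 ^ n by positivity)]
            congr 1; push_cast; ring
          rwa [h2] at h1
      _ = A * ENNReal.ofReal (L ^ (γ * q)) * ENNReal.ofReal τ ^ n := by
          rw [Finset.sum_const, Finset.card_range, nsmul_eq_mul, mul_assoc,
            ← ENNReal.ofReal_mul (by positivity), ← ENNReal.ofReal_pow hτ0.le, mul_assoc,
            ← ENNReal.ofReal_mul (by positivity), ← ENNReal.ofReal_natCast, mul_left_comm,
            ← ENNReal.ofReal_mul (by positivity)]
          congr 2
          rw [Real.div_rpow hL.le (by positivity), hτ, ← Real.rpow_natCast, ← Real.rpow_natCast,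
            ← Real.rpow_mul (by norm_num), ← Real.rpow_mul (by norm_num), Nat.cast_pow,
            Nat.cast_ofNat, ← Real.rpow_natCast 2 n, div_eq_mul_inv, ← Real.rpow_neg (by norm_num),
            mul_assoc, mul_left_comm, ← Real.rpow_add (by norm_num), ← Real.rpow_add (by norm_num)]
          congr 2
          ring
  calc _ ≤ ∫⁻ ω, ENNReal.ofReal (c ^ q) * ENNReal.ofReal (L ^ (-β * q)) * S ω ∂P :=
        lintegral_mono hpath
    _ = ENNReal.ofReal (c ^ q) * ENNReal.ofReal (L ^ (-β * q)) * ∫⁻ ω, S ω ∂P :=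
        lintegral_const_mul _ hSm
    _ ≤ ENNReal.ofReal (c ^ q) * ENNReal.ofReal (L ^ (-β * q))
        * (A * ENNReal.ofReal (L ^ (γ * q)) * ∑' n : ℕ, ENNReal.ofReal τ ^ n) := by gcongr
    _ = ENNReal.ofReal (c ^ q) * (∑' n : ℕ, ENNReal.ofReal τ ^ n) * A
        * (ENNReal.ofReal (L ^ (-β * q)) * ENNReal.ofReal (L ^ (γ * q))) := by ring
    _ = _ := by
        rw [← ENNReal.ofReal_mul (by positivity), ← Real.rpow_add hL]
        congr 3
        ring

end Holder

/-! ### Fractional Brownian motion: moments, modification and growth -/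

section FBM

variable {Ω : Type*} [MeasurableSpace Ω] {P : Measure Ω} {H : ℝ}
  {B : ℝ → Ω → ℝ}

/-- The absolute moment of order `q` of the standard normal distribution. -/
noncomputable def gaussianMoment (q : ℝ) : ℝ≥0∞ := ∫⁻ x, ‖x‖ₑ ^ q ∂(gaussianReal 0 1)

theorem gaussianMoment_ne_top {q : ℝ} (hq : 0 < q) : gaussianMoment q ≠ ∞ := by
  have h := (memLp_id_gaussianReal' (μ := 0) (v := 1) (ENNReal.ofReal q)
    ENNReal.ofReal_ne_top).2
  rw [eLpNorm_lt_top_iff_lintegral_rpow_enorm_lt_top (by simpa using hq)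
    ENNReal.ofReal_ne_top, ENNReal.toReal_ofReal hq.le] at h
  exact h.ne

theorem IsFractionalBrownianMotion.variance_sub [IsProbabilityMeasure P]
    (hB : IsFractionalBrownianMotion H B P)
    (hH : 0 < H) (s t : ℝ) : Var[fun ω => B t ω - B s ω; P] = |t - s| ^ (2 * H) := by
  have hm : ∀ t, MemLp (B t) 2 P := fun t => (hB.gaussian.hasGaussianLaw_eval t).memLp_two
  have h := covariance_sub_sub (μ := P) (hm t) (hm s) (hm t) (hm s)
  rw [covariance_self ((hm t).sub (hm s)).aemeasurable] at h
  have h0 : (0 : ℝ) ^ (2 * H) = 0 := Real.zero_rpow (by linarith)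
  rw [hB.covariance_eq, hB.covariance_eq, hB.covariance_eq, hB.covariance_eq, sub_self, sub_self,
    abs_zero, h0, abs_sub_comm s t] at h
  change Var[B t - B s; P] = _
  rw [h]
  ring

theorem IsFractionalBrownianMotion.lintegral_enorm_sub_rpow [IsProbabilityMeasure P]
    (hB : IsFractionalBrownianMotion H B P) (hH : 0 < H) {q : ℝ} (hq : 0 < q) (s t : ℝ) :
    ∫⁻ ω, ‖B t ω - B s ω‖ₑ ^ q ∂P = gaussianMoment q * ENNReal.ofReal (|t - s| ^ (H * q)) := by
  have hg := hB.gaussian.hasGaussianLaw_fun_sub (s := t) (t := s)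
  have hlaw := hg.map_eq_gaussianReal
  have hm : ∀ t, Integrable (B t) P := fun t => (hB.gaussian.hasGaussianLaw_eval t).integrable
  rw [hB.variance_sub hH, integral_sub (hm t) (hm s), hB.centred, hB.centred, sub_zero] at hlaw
  set c : ℝ := |t - s| ^ H with hc
  have hc2 : |t - s| ^ (2 * H) = c ^ 2 := by
    rw [hc, ← Real.rpow_natCast, ← Real.rpow_mul (abs_nonneg _)]; congr 1; push_cast; ring
  have hmap : (gaussianReal 0 1).map (c * ·) = gaussianReal 0 (|t - s| ^ (2 * H)).toNNReal := by
    rw [gaussianReal_map_const_mul, mul_zero, mul_one]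
    congr 1
    rw [hc2]
    ext
    simp [sq_nonneg]
  have h1 : ∫⁻ ω, ‖B t ω - B s ω‖ₑ ^ q ∂P
      = ∫⁻ x, ‖x‖ₑ ^ q ∂(P.map fun ω => B t ω - B s ω) :=
    (lintegral_map' (f := fun x : ℝ => ‖x‖ₑ ^ q) (by fun_prop) hg.aemeasurable).symm
  rw [h1, hlaw, ← hmap, lintegral_map (by fun_prop) (by fun_prop), gaussianMoment,
    ← lintegral_mul_const _ (by fun_prop)]
  refine lintegral_congr fun x => ?_
  have hc0 : 0 ≤ c := by positivity
  rw [enorm_mul, ENNReal.mul_rpow_of_nonneg _ _ hq.le, mul_comm, Real.enorm_eq_ofReal hc0,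
    ENNReal.ofReal_rpow_of_nonneg hc0 hq.le, hc, ← Real.rpow_mul (abs_nonneg _)]

theorem IsFractionalBrownianMotion.ae_zero (hB : IsFractionalBrownianMotion H B P) (hH : 0 < H) :
    ∀ᵐ ω ∂P, B 0 ω = 0 := by
  have hg := hB.gaussian.hasGaussianLaw_eval 0
  have hv : Var[B 0; P] = 0 := by
    rw [← covariance_self hg.aemeasurable, hB.covariance_eq]
    simp [Real.zero_rpow (show 2 * H ≠ 0 by linarith)]
  have := hg.map_eq_gaussianReal
  rw [hv, hB.centred, Real.toNNReal_zero, gaussianReal_zero_var] at this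
  have h2 : ∀ᵐ x ∂(P.map (B 0)), x = 0 := by
    rw [this]
    simp
  exact ae_of_ae_map hg.aemeasurable h2

/-- A property holding almost surely holds everywhere on a measurable set of full measure. -/
theorem exists_measurableSet_of_ae {p : Ω → Prop} (h : ∀ᵐ ω ∂P, p ω) :
    ∃ G : Set Ω, MeasurableSet G ∧ (∀ᵐ ω ∂P, ω ∈ G) ∧ ∀ ω ∈ G, p ω := by
  obtain ⟨N, hN, hNm, hN0⟩ := exists_measurable_superset_of_null (ae_iff.1 h)
  refine ⟨Nᶜ, hNm.compl, ?_, fun ω hω => by_contra fun hp => hω (hN hp)⟩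
  rw [ae_iff]
  simpa using hN0

/-- An almost surely continuous process with almost everywhere measurable marginals agrees, almost
surely at all times, with a measurable process all of whose paths are continuous. -/
theorem exists_measurable_continuous_modification (hm : ∀ t, AEMeasurable (B t) P)
    (hc : ∀ᵐ ω ∂P, Continuous fun t => B t ω) :
    ∃ W : ℝ → Ω → ℝ, (∀ᵐ ω ∂P, ∀ t, W t ω = B t ω) ∧ (∀ t, Measurable (W t)) ∧
      ∀ ω, Continuous fun t => W t ω := by
  have hq : ∀ᵐ ω ∂P, ∀ r : ℚ, B r ω = (hm r).mk (B r) ω := ae_all_iff.2 fun r => (hm r).ae_eq_mk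
  obtain ⟨G, hGm, hG, hGp⟩ := exists_measurableSet_of_ae (hc.and hq)
  have hW : ∀ ω, Continuous fun t => G.indicator (B t) ω := fun ω => by
    by_cases hω : ω ∈ G
    · simpa [hω] using (hGp ω hω).1
    · simpa [hω] using continuous_const
  refine ⟨fun t => G.indicator (B t), hG.mono fun ω hω t => by simp [hω], fun t => ?_, hW⟩
  have hr : ∀ r : ℚ, Measurable (G.indicator (B r)) := fun r => by
    have : G.indicator (B r) = G.indicator ((hm r).mk (B r)) :=
      Set.indicator_congr fun ω hω => (hGp ω hω).2 r
    rw [this]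
    exact (hm r).measurable_mk.indicator hGm
  -- Every real time is a limit of rational times.
  obtain ⟨u, hu⟩ : ∃ u : ℕ → ℚ, Tendsto (fun n => (u n : ℝ)) atTop (𝓝 t) := by
    obtain ⟨v, hv, hvt⟩ := mem_closure_iff_seq_limit.1 (Rat.denseRange_cast (𝕜 := ℝ) t)
    choose u hu using hv
    exact ⟨u, by simpa only [hu] using hvt⟩
  exact measurable_of_tendsto_metrizable (fun n => hr (u n))
    (tendsto_pi_nhds.2 fun ω => ((hW ω).tendsto t).comp hu)

/-- Linear growth of the Hölder seminorms over `[-N, 0]` makes a path subexponential at `-∞`. -/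
theorem isSubexpAtBot_of_holderSemi_le {b : ℝ → ℝ} {β : ℝ} (hβ : 0 < β) (hβ1 : β ≤ 1)
    {K : NNReal} (h : ∀ N : ℕ, holderSemi β N (fun s => b (-s)) ≤ K * (N + 1)) :
    IsSubexpAtBot b := by
  intro c hc
  refine ⟨|b 0| + K * (2 * Real.exp (2 * c) / c ^ 2), fun s hs => ?_⟩
  set x : ℝ := -s with hx
  have hx0 : 0 ≤ x := by linarith
  set N := ⌈x⌉₊ with hN
  have hxN : x ≤ N := Nat.le_ceil x
  have hNx : (N : ℝ) ≤ x + 1 := (Nat.ceil_lt_add_one hx0).le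
  have h1 := enorm_sub_le_holderSemi β (fun s => b (-s)) (t := N) (s := x) (r := 0) ⟨hx0, hxN⟩
    ⟨le_rfl, hx0.trans hxN⟩
  have h2 : |b s - b 0| ≤ K * (N + 1) * x ^ β := by
    have h3 := h1.trans (mul_le_mul_left (h N) _)
    have h4 : ((K : ℝ≥0∞) * (N + 1)) = ENNReal.ofReal (K * (N + 1)) := by
      rw [ENNReal.ofReal_mul K.coe_nonneg, ENNReal.ofReal_coe_nnreal,
        ENNReal.ofReal_add (by positivity) (by norm_num)]
      simp
    rw [h4, ← ENNReal.ofReal_mul (by positivity), ← ofReal_norm, ENNReal.ofReal_le_ofReal_iff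
      (by positivity)] at h3
    rwa [sub_zero, abs_of_nonneg hx0, Real.norm_eq_abs, neg_zero, hx, neg_neg, ← hx] at h3
  have h5 : x ^ β ≤ x + 2 := by
    calc x ^ β ≤ (x + 2) ^ β := by gcongr; linarith
      _ ≤ (x + 2) ^ (1 : ℝ) := Real.rpow_le_rpow_of_exponent_le (by linarith) hβ1
      _ = _ := Real.rpow_one _
  have h6 : (x + 2) ^ 2 ≤ 2 * Real.exp (2 * c) / c ^ 2 * Real.exp (c * x) := by
    have := Real.pow_div_factorial_le_exp (c * (x + 2)) (by positivity) 2
    have h7 : Real.exp (c * (x + 2)) = Real.exp (2 * c) * Real.exp (c * x) := by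
      rw [← Real.exp_add]; congr 1; ring
    rw [h7] at this
    norm_num [Nat.factorial] at this
    rw [div_mul_eq_mul_div, le_div_iff₀ (by positivity)]
    linarith [mul_pow c (x + 2) 2]
  have h8 : (1 : ℝ) ≤ Real.exp (c * x) := Real.one_le_exp (by positivity)
  have h9 : -(c * s) = c * x := by rw [hx]; ring
  rw [h9]
  calc |b s| ≤ |b 0| + |b s - b 0| := by
        have := abs_add_le (b 0) (b s - b 0)
        rwa [add_sub_cancel] at this
    _ ≤ |b 0| * Real.exp (c * x) + K * ((x + 2) * (x + 2)) := by
        refine add_le_add (le_mul_of_one_le_right (abs_nonneg _) h8) (h2.trans ?_)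
        rw [mul_assoc]
        exact mul_le_mul_of_nonneg_left (mul_le_mul (by linarith) h5 (by positivity)
          (by positivity)) K.coe_nonneg
    _ ≤ |b 0| * Real.exp (c * x)
        + K * (2 * Real.exp (2 * c) / c ^ 2 * Real.exp (c * x)) := by
        rw [← sq]
        gcongr
    _ = _ := by ring

/-- Kolmogorov's estimate on `[-N, 0]` and summation over `N` give seminorms growing at most
linearly; the moment of order `4 / H` suffices to make the sum converge. -/
theorem ae_isSubexpAtBot {W : ℝ → Ω → ℝ} {q : ℝ} (hH : 0 < H) (hH1 : H < 1) (hq : q = 4 / H)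
    (hWm : ∀ t, Measurable (W t)) (hWc : ∀ ω, Continuous fun t => W t ω) {A : ℝ≥0∞} (hA : A ≠ ∞)
    (hmom : ∀ s t, ∫⁻ ω, ‖W t ω - W s ω‖ₑ ^ q ∂P ≤ A * ENNReal.ofReal (|t - s| ^ (H * q))) :
    ∀ᵐ ω ∂P, IsSubexpAtBot fun t => W t ω := by
  have hHq : H * q = 4 := by rw [hq]; field_simp
  have hq0 : 0 < q := by rw [hq]; positivity
  have hq4 : 4 ≤ q := by
    rw [hq, le_div_iff₀ hH]; linarith
  obtain ⟨C, hC⟩ := lintegral_holderSemi_rpow_le (E := ℝ) P (β := H / 2) (γ := H) (q := q)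
    (by positivity) hq0 (by linarith)
  set h : ℕ → Ω → ℝ≥0∞ := fun N ω => holderSemi (H / 2) N (fun s => W (-s) ω) with hh
  have hm : ∀ N, Measurable (h N) := fun N => measurable_holderSemi (H / 2) N
    (fun s r => ((hWm (-s)).sub (hWm (-r))).enorm) fun ω => (hWc ω).comp continuous_neg
  have hE : ∀ N : ℕ, ∫⁻ ω, h N ω ^ q ∂P ≤ C * A * ENNReal.ofReal ((N : ℝ) ^ 2) := by
    intro N
    refine (hC (fun s ω => W (-s) ω) N A N.cast_nonneg (fun ω => (hWc ω).comp continuous_neg)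
      (fun s r => ((hWm (-s)).sub (hWm (-r))).enorm) fun s _ r _ => ?_).trans_eq ?_
    · have := hmom (-r) (-s)
      rwa [show -s - -r = -(s - r) by ring, abs_neg] at this
    · rw [show (H - H / 2) * q = ((2 : ℕ) : ℝ) by push_cast; linarith, Real.rpow_natCast]
  -- The weighted sum of the moments over all `N` is finite.
  have hsum : ∫⁻ ω, ∑' N : ℕ, h N ω ^ q * ((N : ℝ≥0∞) + 1) ^ (-q) ∂P ≠ ∞ := by
    rw [lintegral_tsum fun N => (((hm N).pow_const q).mul_const _).aemeasurable]
    have hb : ∀ N : ℕ, ∫⁻ ω, h N ω ^ q * ((N : ℝ≥0∞) + 1) ^ (-q) ∂P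
        ≤ C * A * ENNReal.ofReal (((N + 1 : ℕ) : ℝ) ^ 2)⁻¹ := by
      intro N
      have hN : ((N : ℝ≥0∞) + 1) = ENNReal.ofReal ((N + 1 : ℕ) : ℝ) := by
        rw [ENNReal.ofReal_natCast]; push_cast; rfl
      have hN1 : (1 : ℝ) ≤ ((N + 1 : ℕ) : ℝ) := by push_cast; linarith [N.cast_nonneg (α := ℝ)]
      rw [lintegral_mul_const _ ((hm N).pow_const q)]
      refine (mul_le_mul_left (hE N) _).trans ?_
      rw [mul_assoc, hN, ENNReal.ofReal_rpow_of_pos (by positivity),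
        ← ENNReal.ofReal_mul (by positivity)]
      gcongr
      calc (N : ℝ) ^ 2 * ((N + 1 : ℕ) : ℝ) ^ (-q)
          ≤ ((N + 1 : ℕ) : ℝ) ^ 2 * ((N + 1 : ℕ) : ℝ) ^ (-4 : ℝ) := by
            gcongr
            linarith
        _ = _ := by
            rw [Real.rpow_neg (by positivity), show (4 : ℝ) = ((4 : ℕ) : ℝ) by norm_num,
              Real.rpow_natCast]
            field_simp
    refine ne_top_of_le_ne_top ?_ (ENNReal.tsum_le_tsum hb)
    rw [ENNReal.tsum_mul_left]
    refine ENNReal.mul_ne_top (ENNReal.mul_ne_top ENNReal.coe_ne_top hA) ?_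
    have hs : Summable fun N : ℕ => (((N + 1 : ℕ) : ℝ) ^ 2)⁻¹ :=
      (summable_nat_add_iff 1).2 (Real.summable_nat_pow_inv.2 (by norm_num))
    exact hs.tsum_ofReal_ne_top
  have hae := ae_lt_top' (Measurable.tsum fun N =>
    ((hm N).pow_const q).mul_const _).aemeasurable hsum
  filter_upwards [hae] with ω hω
  set S := ∑' N : ℕ, h N ω ^ q * ((N : ℝ≥0∞) + 1) ^ (-q) with hS
  have hSq : S ^ q⁻¹ ≠ ∞ := ENNReal.rpow_ne_top_of_nonneg (by positivity) hω.ne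
  refine isSubexpAtBot_of_holderSemi_le (β := H / 2) (K := (S ^ q⁻¹).toNNReal) (by positivity)
    (by linarith) fun N => ?_
  rw [ENNReal.coe_toNNReal hSq]
  have h1 : h N ω ^ q * ((N : ℝ≥0∞) + 1) ^ (-q) ≤ S := ENNReal.le_tsum N
  have h0 : ((N : ℝ≥0∞) + 1) ^ q ≠ 0 := by simp [ENNReal.rpow_eq_zero_iff, hq0.not_gt]
  have ht : ((N : ℝ≥0∞) + 1) ^ q ≠ ∞ := ENNReal.rpow_ne_top_of_nonneg hq0.le (by finiteness)
  rw [ENNReal.rpow_neg, ← div_eq_mul_inv, ENNReal.div_le_iff h0 ht] at h1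
  rw [← ENNReal.rpow_le_rpow_iff hq0, ENNReal.mul_rpow_of_nonneg _ _ hq0.le,
    ← ENNReal.rpow_mul, inv_mul_cancel₀ hq0.ne', ENNReal.rpow_one]
  exact h1

/-- The properties of a version of fractional Brownian motion with which all pathwise arguments
can be carried out at every sample point. -/
structure IsGoodVersion (H : ℝ) (W : ℝ → Ω → ℝ) (P : Measure Ω) : Prop where
  measurable : ∀ t, Measurable (W t)
  continuous : ∀ ω, Continuous fun t => W t ω
  zero : ∀ ω, W 0 ω = 0
  subexp : ∀ ω, IsSubexpAtBot fun t => W t ω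
  moment : ∀ q, 0 < q → ∀ s t, ∫⁻ ω, ‖W t ω - W s ω‖ₑ ^ q ∂P
    = gaussianMoment q * ENNReal.ofReal (|t - s| ^ (H * q))

theorem IsFractionalBrownianMotion.exists_isGoodVersion [IsProbabilityMeasure P]
    (hB : IsFractionalBrownianMotion H B P) (hH : 0 < H) (hH1 : H < 1) :
    ∃ W : ℝ → Ω → ℝ, (∀ᵐ ω ∂P, ∀ t, W t ω = B t ω) ∧ IsGoodVersion H W P := by
  obtain ⟨V, hVB, hVm, hVc⟩ := exists_measurable_continuous_modification
    (fun t => hB.gaussian.aemeasurable t) hB.continuous_paths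
  have hVmom : ∀ q, 0 < q → ∀ s t, ∫⁻ ω, ‖V t ω - V s ω‖ₑ ^ q ∂P
      = gaussianMoment q * ENNReal.ofReal (|t - s| ^ (H * q)) := fun q hq s t => by
    rw [← hB.lintegral_enorm_sub_rpow hH hq s t]
    exact lintegral_congr_ae (hVB.mono fun ω hω => by simp only [hω])
  have hsub := ae_isSubexpAtBot (q := 4 / H) hH hH1 rfl hVm hVc
    (gaussianMoment_ne_top (by positivity)) fun s t => (hVmom _ (by positivity) s t).le
  have hzero : ∀ᵐ ω ∂P, V 0 ω = 0 := by
    filter_upwards [hVB, hB.ae_zero hH] with ω h1 h2 using (h1 0).trans h2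
  obtain ⟨G, hGm, hG, hGp⟩ := exists_measurableSet_of_ae (hsub.and hzero)
  refine ⟨fun t => G.indicator (V t), ?_, fun t => (hVm t).indicator hGm, fun ω => ?_, fun ω => ?_,
    fun ω => ?_, fun q hq s t => ?_⟩
  · filter_upwards [hVB, hG] with ω h1 h2 t
    simp [h2, h1]
  · by_cases hω : ω ∈ G
    · simpa [hω] using hVc ω
    · simpa [hω] using continuous_const
  · by_cases hω : ω ∈ G
    · simpa [hω] using (hGp ω hω).2
    · simp [hω]
  · by_cases hω : ω ∈ G
    · simpa [hω] using (hGp ω hω).1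
    · intro c _
      exact ⟨0, fun s _ => by simp [hω]⟩
  · rw [← hVmom q hq s t]
    exact lintegral_congr_ae (hG.mono fun ω hω => by simp [hω])

end FBM

/-! ### Moments of the difference between the smoothed and the original driver -/

section Driver

variable {Ω : Type*} [MeasurableSpace Ω] {P : Measure Ω} {H : ℝ} {W : ℝ → Ω → ℝ}

/-- Jensen's inequality for the absolute moment of order `q`. -/
theorem enorm_integral_rpow_le {α : Type*} [MeasurableSpace α] (μ : Measure α)
    [IsProbabilityMeasure μ] {g : α → ℝ} (hg : AEStronglyMeasurable g μ) {q : ℝ} (hq : 1 ≤ q) :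
    ‖∫ v, g v ∂μ‖ₑ ^ q ≤ ∫⁻ v, ‖g v‖ₑ ^ q ∂μ := by
  have hq0 : 0 < q := by linarith
  have h := eLpNorm_le_eLpNorm_of_exponent_le (μ := μ) (p := 1) (q := ENNReal.ofReal q)
    (by simpa using hq) hg
  rw [eLpNorm_one_eq_lintegral_enorm, eLpNorm_eq_lintegral_rpow_enorm_toReal (by simpa using hq0)
    ENNReal.ofReal_ne_top, ENNReal.toReal_ofReal hq0.le] at h
  calc _ ≤ (∫⁻ v, ‖g v‖ₑ ∂μ) ^ q := by gcongr; exact enorm_integral_le_lintegral_enorm _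
    _ ≤ ((∫⁻ v, ‖g v‖ₑ ^ q ∂μ) ^ (1 / q)) ^ q := by gcongr
    _ = _ := by rw [← ENNReal.rpow_mul, one_div_mul_cancel hq0.ne', ENNReal.rpow_one]

theorem lintegral_expLaw_rpow_ne_top {a : ℝ} (ha : 0 < a) :
    ∫⁻ v, ENNReal.ofReal (|v| ^ a) ∂expLaw ≠ ∞ := by
  have h := Real.GammaIntegral_convergent (s := a + 1) (by linarith)
  rw [expLaw, lintegral_withDensity_eq_lintegral_mul _ (by fun_prop) (by fun_prop)]
  have h2 := h.2
  rw [hasFiniteIntegral_iff_enorm] at h2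
  refine ne_of_lt (lt_of_le_of_lt (le_of_eq ?_) h2)
  refine setLIntegral_congr_fun measurableSet_Ioi fun v hv => ?_
  have hv : 0 < v := hv
  simp only [Pi.mul_apply]
  rw [← ENNReal.ofReal_mul (Real.exp_pos _).le, abs_of_pos hv, add_sub_cancel_right,
    Real.enorm_eq_ofReal (by positivity)]

/-- Interpolation between two bounds of order `H`. -/
theorem min_rpow_le {x y q γ : ℝ} (hx : 0 ≤ x) (hy : 0 ≤ y) (hq : 0 < q) (hγ : 0 < γ)
    (hγH : γ < H) : min (x ^ (H * q)) (y ^ (H * q)) ≤ x ^ ((H - γ) * q) * y ^ (γ * q) := by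
  have h1 : 0 < (H - γ) * q := mul_pos (by linarith) hq
  have h2 : 0 < γ * q := mul_pos hγ hq
  have h3 : H * q = (H - γ) * q + γ * q := by ring
  rcases le_total x y with h | h
  · refine (min_le_left _ _).trans ?_
    rw [h3, Real.rpow_add_of_nonneg hx h1.le h2.le]
    gcongr
  · refine (min_le_right _ _).trans ?_
    rw [h3, Real.rpow_add_of_nonneg hy h1.le h2.le]
    gcongr

theorem IsGoodVersion.integrable_expLaw (hW : IsGoodVersion H W P) {ε : ℝ} (hε : 0 < ε) (t : ℝ)
    (ω : Ω) : Integrable (fun v => W (t - ε * v) ω) expLaw :=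
  (hW.subexp ω).integrable_expLaw (hW.continuous ω) hε t

theorem IsGoodVersion.measurable_expAverage (hW : IsGoodVersion H W P) {ε : ℝ} (hε : 0 < ε)
    (t : ℝ) : Measurable fun ω => expAverage ε (fun s => W s ω) t := by
  have h1 : Measurable (Function.uncurry W) :=
    measurable_uncurry_of_continuous_of_measurable hW.continuous hW.measurable
  have h2 : Measurable (Function.uncurry fun (ω : Ω) (v : ℝ) => W (t - ε * v) ω) :=
    h1.comp (f := fun p : Ω × ℝ => (t - ε * p.2, p.1)) (by fun_prop)
  simp_rw [fun ω => expAverage_eq_integral_expLaw (fun s => W s ω) hε t]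
  exact (h2.stronglyMeasurable.integral_prod_right (ν := expLaw)).measurable

/-- Increments of `W - expAverage ε W` are small either because the process itself is of size
`ε ^ H`, or because the time increment is; interpolating gives every intermediate exponent. -/
theorem IsGoodVersion.lintegral_sub_expAverage_rpow_le [SFinite P] (hW : IsGoodVersion H W P)
    {γ q : ℝ} (hγ : 0 < γ) (hγH : γ < H) (hq : 1 ≤ q) :
    ∃ K : NNReal, ∀ ε > 0, ∀ s t : ℝ,
      ∫⁻ ω, ‖(W t ω - expAverage ε (fun s => W s ω) t)
        - (W s ω - expAverage ε (fun s => W s ω) s)‖ₑ ^ q ∂P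
      ≤ K * ENNReal.ofReal (ε ^ ((H - γ) * q)) * ENNReal.ofReal (|t - s| ^ (γ * q)) := by
  have hq0 : 0 < q := by linarith
  have ha : 0 < (H - γ) * q := mul_pos (by linarith) hq0
  set m := ∫⁻ v, ENNReal.ofReal (|v| ^ ((H - γ) * q)) ∂expLaw with hm
  have hmt : m ≠ ∞ := lintegral_expLaw_rpow_ne_top ha
  set K : ℝ≥0∞ := 2 ^ (q - 1) * 2 * gaussianMoment q with hK
  have hKt : K ≠ ∞ := ENNReal.mul_ne_top (by finiteness) (gaussianMoment_ne_top hq0)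
  refine ⟨(K * m).toNNReal, fun ε hε s t => ?_⟩
  rw [ENNReal.coe_toNNReal (ENNReal.mul_ne_top hKt hmt)]
  have hWu : Measurable (Function.uncurry W) :=
    measurable_uncurry_of_continuous_of_measurable hW.continuous hW.measurable
  set g : ℝ → Ω → ℝ := fun v ω => (W t ω - W (t - ε * v) ω) - (W s ω - W (s - ε * v) ω) with hg
  have hrep : ∀ ω, (W t ω - expAverage ε (fun s => W s ω) t)
      - (W s ω - expAverage ε (fun s => W s ω) s) = ∫ v, g v ω ∂expLaw := by
    intro ω
    have hi := hW.integrable_expLaw hε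
    have hc : ∀ c : ℝ, Integrable (fun _ : ℝ => c) expLaw := fun c => integrable_const c
    have hd : ∀ r, Integrable (fun v => W r ω - W (r - ε * v) ω) expLaw := fun r =>
      (hc _).sub (hi r ω)
    simp only [hg]
    rw [integral_sub (hd t) (hd s), integral_sub (hc _) (hi t ω),
      integral_sub (hc _) (hi s ω), expAverage_eq_integral_expLaw _ hε,
      expAverage_eq_integral_expLaw _ hε]
    simp
  have hgm : Measurable (Function.uncurry fun (ω : Ω) (v : ℝ) => g v ω) := by
    have h1 : ∀ r : ℝ, Measurable fun p : Ω × ℝ => W r p.1 := fun r =>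
      (hW.measurable r).comp measurable_fst
    have h2 : ∀ r : ℝ, Measurable fun p : Ω × ℝ => W (r - ε * p.2) p.1 := fun r =>
      hWu.comp (f := fun p : Ω × ℝ => (r - ε * p.2, p.1)) (by fun_prop)
    exact ((h1 t).sub (h2 t)).sub ((h1 s).sub (h2 s))
  have hinc : ∀ r r', Measurable fun ω => ‖W r ω - W r' ω‖ₑ ^ q := fun r r' =>
    ((hW.measurable r).sub (hW.measurable r')).enorm.pow_const q
  have htwo : ∀ x y : ℝ, ‖x - y‖ₑ ^ q ≤ 2 ^ (q - 1) * (‖x‖ₑ ^ q + ‖y‖ₑ ^ q) := fun x y =>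
    (by gcongr; exact enorm_sub_le : ‖x - y‖ₑ ^ q ≤ (‖x‖ₑ + ‖y‖ₑ) ^ q).trans
      (ENNReal.rpow_add_le_mul_rpow_add_rpow _ _ hq)
  have hdiff : ∀ (r₁ r₂ r₃ r₄ ℓ : ℝ), |r₁ - r₂| = ℓ → |r₃ - r₄| = ℓ →
      ∫⁻ ω, ‖(W r₁ ω - W r₂ ω) - (W r₃ ω - W r₄ ω)‖ₑ ^ q ∂P ≤ K * ENNReal.ofReal (ℓ ^ (H * q)) := by
    intro r₁ r₂ r₃ r₄ ℓ h1 h2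
    refine (lintegral_mono fun ω => htwo _ _).trans_eq ?_
    have hadd : Measurable fun ω => ‖W r₁ ω - W r₂ ω‖ₑ ^ q + ‖W r₃ ω - W r₄ ω‖ₑ ^ q :=
      (hinc _ _).add (hinc _ _)
    rw [lintegral_const_mul _ hadd, lintegral_add_left (hinc _ _),
      hW.moment q hq0, hW.moment q hq0, h1, h2, hK]
    ring
  have hv : ∀ v, ∫⁻ ω, ‖g v ω‖ₑ ^ q ∂P ≤ K * (ENNReal.ofReal (ε ^ ((H - γ) * q))
      * ENNReal.ofReal (|t - s| ^ (γ * q))) * ENNReal.ofReal (|v| ^ ((H - γ) * q)) := by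
    intro v
    -- The second difference `g v` pairs into increments of length `ε v`, or of length
    -- `|t - s|`.
    have h1 : ∫⁻ ω, ‖g v ω‖ₑ ^ q ∂P ≤ K * ENNReal.ofReal ((ε * |v|) ^ (H * q)) :=
      hdiff t (t - ε * v) s (s - ε * v) (ε * |v|) (by
        rw [sub_sub_cancel, abs_mul, abs_of_pos hε]) (by
        rw [sub_sub_cancel, abs_mul, abs_of_pos hε])
    have h2 : ∫⁻ ω, ‖g v ω‖ₑ ^ q ∂P ≤ K * ENNReal.ofReal (|t - s| ^ (H * q)) := by
      have := hdiff t s (t - ε * v) (s - ε * v) |t - s| rfl (by congr 1; ring)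
      refine (lintegral_mono fun ω => le_of_eq ?_).trans this
      congr 2
      simp only [hg]
      ring
    have h3 : ∫⁻ ω, ‖g v ω‖ₑ ^ q ∂P
        ≤ K * ENNReal.ofReal (min ((ε * |v|) ^ (H * q)) (|t - s| ^ (H * q))) := by
      rcases min_choice ((ε * |v|) ^ (H * q)) (|t - s| ^ (H * q)) with h | h <;> rw [h] <;>
        assumption
    refine h3.trans ?_
    rw [mul_assoc K, ← ENNReal.ofReal_mul (by positivity), ← ENNReal.ofReal_mul (by positivity)]
    gcongr
    refine (min_rpow_le (by positivity) (abs_nonneg _) hq0 hγ hγH).trans_eq ?_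
    rw [Real.mul_rpow hε.le (abs_nonneg v)]
    ring
  calc _ ≤ ∫⁻ ω, ∫⁻ v, ‖g v ω‖ₑ ^ q ∂expLaw ∂P := by
        refine lintegral_mono fun ω => ?_
        rw [hrep]
        exact enorm_integral_rpow_le expLaw
          (hgm.comp (measurable_prodMk_left (x := ω))).aestronglyMeasurable hq
    _ = ∫⁻ v, ∫⁻ ω, ‖g v ω‖ₑ ^ q ∂P ∂expLaw :=
        lintegral_lintegral_swap (hgm.enorm.pow_const q).aemeasurable
    _ ≤ ∫⁻ v, K * (ENNReal.ofReal (ε ^ ((H - γ) * q)) * ENNReal.ofReal (|t - s| ^ (γ * q)))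
          * ENNReal.ofReal (|v| ^ ((H - γ) * q)) ∂expLaw := lintegral_mono hv
    _ = _ := by
        rw [lintegral_const_mul _ (by fun_prop), ← hm]
        ring

/-- The difference between the driver `σ (A_t - A_0)` of the slow equation, `A` being the
exponential moving average of `b`, and the limiting driver `σ b`. -/
noncomputable def driverError (σ ε : ℝ) (b : ℝ → ℝ) (t : ℝ) : ℝ :=
  σ * (expAverage ε b t - expAverage ε b 0) - σ * b t

theorem IsGoodVersion.measurable_driverError (hW : IsGoodVersion H W P) (σ : ℝ) {ε : ℝ}
    (hε : 0 < ε) (t : ℝ) : Measurable fun ω => driverError σ ε (fun s => W s ω) t :=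
  (((hW.measurable_expAverage hε t).sub (hW.measurable_expAverage hε 0)).const_mul σ).sub
    ((hW.measurable t).const_mul σ)

theorem IsGoodVersion.continuous_driverError (hW : IsGoodVersion H W P) (σ : ℝ) {ε : ℝ}
    (hε : 0 < ε) (ω : Ω) : Continuous fun t => driverError σ ε (fun s => W s ω) t := by
  have h1 := continuous_expAverage (hW.subexp ω) (hW.continuous ω) hε
  have h2 := hW.continuous ω
  unfold driverError
  fun_prop

theorem driverError_zero {σ ε : ℝ} {b : ℝ → ℝ} (hb : b 0 = 0) : driverError σ ε b 0 = 0 := by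
  simp [driverError, hb]

/-- `L^p` bounds deduced from a moment of an order `q ≥ p`. -/
theorem eLpNorm_le_of_lintegral_rpow_le [IsProbabilityMeasure P] {f : Ω → ℝ≥0∞}
    (hf : Measurable f) {p q : ℝ} (hp : 0 < p) (hpq : p ≤ q) {C : NNReal} {x : ℝ} (hx : 0 ≤ x)
    (h : ∫⁻ ω, f ω ^ q ∂P ≤ C * ENNReal.ofReal (x ^ q)) :
    eLpNorm f (ENNReal.ofReal p) P ≤ (C ^ (1 / q) : NNReal) * ENNReal.ofReal x := by
  have hq : 0 < q := hp.trans_le hpq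
  refine (eLpNorm_le_eLpNorm_of_exponent_le (ENNReal.ofReal_le_ofReal hpq)
    hf.aestronglyMeasurable).trans ?_
  rw [eLpNorm_eq_lintegral_rpow_enorm_toReal (by simpa using hq) ENNReal.ofReal_ne_top,
    ENNReal.toReal_ofReal hq.le]
  simp only [enorm_eq_self]
  calc _ ≤ (C * ENNReal.ofReal (x ^ q)) ^ (1 / q) := by gcongr
    _ = _ := by
      rw [ENNReal.mul_rpow_of_nonneg _ _ (by positivity), ← ENNReal.ofReal_rpow_of_nonneg hx hq.le,
        ← ENNReal.rpow_mul, mul_one_div_cancel hq.ne', ENNReal.rpow_one,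
        ENNReal.coe_rpow_of_nonneg _ (by positivity)]

/-- An exponent `q ≥ p` large enough for Kolmogorov's estimate from exponent `γ` to `γ'`. -/
theorem exists_kolmogorov_exponent {γ γ' p : ℝ} (h : γ' < γ) (hp : 1 ≤ p) :
    ∃ q, p ≤ q ∧ 1 ≤ q ∧ 0 < q ∧ 1 + γ' * q < γ * q := by
  refine ⟨p + 2 / (γ - γ'), ?_, ?_, ?_, ?_⟩
  · have : 0 < 2 / (γ - γ') := div_pos two_pos (by linarith)
    linarith
  · have : 0 < 2 / (γ - γ') := div_pos two_pos (by linarith)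
    linarith
  · have : 0 < 2 / (γ - γ') := div_pos two_pos (by linarith)
    linarith
  · have h1 : (γ - γ') * (2 / (γ - γ')) = 2 := mul_div_cancel₀ _ (by linarith)
    have h2 : 0 < (γ - γ') * p := mul_pos (by linarith) (by linarith)
    nlinarith

/-- The two drivers are close in Hölder seminorm: Kolmogorov's estimate applied to the interpolated
moments of the increments. -/
theorem IsGoodVersion.eLpNorm_holderSemi_driverError_le [IsProbabilityMeasure P]
    (hW : IsGoodVersion H W P) (σ : ℝ) {γ γ' p : ℝ} (hγ' : 0 < γ') (hγ : γ' < γ) (hγH : γ < H)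
    (hp : 1 ≤ p) :
    ∃ C : NNReal, ∀ ε > 0, ∀ t, 0 ≤ t →
      eLpNorm (fun ω => holderSemi γ' t (driverError σ ε fun s => W s ω)) (ENNReal.ofReal p) P
        ≤ C * ENNReal.ofReal (t ^ (γ - γ') * ε ^ (H - γ)) := by
  obtain ⟨q, hpq, hq1, hq0, hq⟩ := exists_kolmogorov_exponent hγ hp
  obtain ⟨K, hK⟩ := hW.lintegral_sub_expAverage_rpow_le (hγ'.trans hγ) hγH hq1
  obtain ⟨C, hC⟩ := lintegral_holderSemi_rpow_le (E := ℝ) P hγ' hq0 hq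
  set k : NNReal := Real.toNNReal (|σ| ^ q) with hk
  have hkσ : ENNReal.ofReal (|σ| ^ q) = k := rfl
  refine ⟨(C * (k * K)) ^ (1 / q), fun ε hε t ht => ?_⟩
  have hcont := hW.continuous_driverError σ hε
  have hmeas : ∀ s r, Measurable fun ω => ‖driverError σ ε (fun s => W s ω) s
      - driverError σ ε (fun s => W s ω) r‖ₑ := fun s r =>
    ((hW.measurable_driverError σ hε s).sub (hW.measurable_driverError σ hε r)).enorm
  refine eLpNorm_le_of_lintegral_rpow_le (measurable_holderSemi γ' t
    (Z := fun s ω => driverError σ ε (fun s => W s ω) s) hmeas hcont) (by linarith) hpq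
    (by positivity) ?_
  refine (hC (fun s ω => driverError σ ε (fun s => W s ω) s) t
    (k * K * ENNReal.ofReal (ε ^ ((H - γ) * q))) ht hcont hmeas fun s _ r _ => ?_).trans_eq ?_
  · have h1 : ∀ ω, ‖driverError σ ε (fun s => W s ω) s - driverError σ ε (fun s => W s ω) r‖ₑ ^ q
        = k * ‖(W s ω - expAverage ε (fun s => W s ω) s)
          - (W r ω - expAverage ε (fun s => W s ω) r)‖ₑ ^ q := fun ω => by
      rw [← hkσ, ← ENNReal.ofReal_rpow_of_nonneg (abs_nonneg σ) hq0.le,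
        ← ENNReal.mul_rpow_of_nonneg _ _ hq0.le, ← Real.enorm_eq_ofReal_abs, ← enorm_mul,
        ← enorm_neg]
      congr 2
      simp only [driverError]
      ring
    have hm : ∀ r, Measurable fun ω => W r ω - expAverage ε (fun s => W s ω) r := fun r =>
      (hW.measurable r).sub (hW.measurable_expAverage hε r)
    have hm' : Measurable fun ω => ‖(W s ω - expAverage ε (fun s => W s ω) s)
        - (W r ω - expAverage ε (fun s => W s ω) r)‖ₑ ^ q :=
      ((hm s).sub (hm r)).enorm.pow_const q
    simp_rw [h1]
    rw [lintegral_const_mul _ hm', mul_assoc, mul_assoc]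
    gcongr
    rw [← mul_assoc]
    exact hK ε hε r s
  · rw [Real.mul_rpow (by positivity) (by positivity), ← Real.rpow_mul ht, ← Real.rpow_mul hε.le,
      ENNReal.ofReal_mul (by positivity)]
    push_cast
    ring

theorem IsGoodVersion.eLpNorm_holderSemi_lt_top [IsProbabilityMeasure P]
    (hW : IsGoodVersion H W P) (σ : ℝ) {β p T : ℝ} (hβ : 0 < β) (hβH : β < H) (hp : 1 ≤ p)
    (hT : 0 ≤ T) :
    eLpNorm (fun ω => holderSemi β T fun s => σ * W s ω) (ENNReal.ofReal p) P < ∞ := by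
  obtain ⟨q, hpq, hq1, hq0, hq⟩ := exists_kolmogorov_exponent hβH hp
  obtain ⟨C, hC⟩ := lintegral_holderSemi_rpow_le (E := ℝ) P hβ hq0 hq
  set k : NNReal := Real.toNNReal (|σ| ^ q) with hk
  have hkσ : ENNReal.ofReal (|σ| ^ q) = k := rfl
  have hcont : ∀ ω, Continuous fun s => σ * W s ω := fun ω => (hW.continuous ω).const_mul σ
  have hmeas : ∀ s r, Measurable fun ω => ‖σ * W s ω - σ * W r ω‖ₑ := fun s r =>
    (((hW.measurable s).const_mul σ).sub ((hW.measurable r).const_mul σ)).enorm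
  have hmom := hC (fun s ω => σ * W s ω) T (k * gaussianMoment q) hT hcont hmeas fun s _ r _ => by
    have h1 : ∀ ω, ‖σ * W s ω - σ * W r ω‖ₑ ^ q = k * ‖W s ω - W r ω‖ₑ ^ q := fun ω => by
      rw [← hkσ, ← ENNReal.ofReal_rpow_of_nonneg (abs_nonneg σ) hq0.le,
        ← ENNReal.mul_rpow_of_nonneg _ _ hq0.le, ← Real.enorm_eq_ofReal_abs, ← enorm_mul, mul_sub]
    have hm : Measurable fun ω => ‖W s ω - W r ω‖ₑ ^ q :=
      ((hW.measurable s).sub (hW.measurable r)).enorm.pow_const q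
    simp_rw [h1]
    rw [lintegral_const_mul _ hm,
      hW.moment q hq0, mul_assoc]
  have hg := gaussianMoment_ne_top hq0
  refine lt_of_le_of_lt (eLpNorm_le_of_lintegral_rpow_le (x := T ^ (H - β))
    (C := C * (k * (gaussianMoment q).toNNReal))
    (measurable_holderSemi β T (Z := fun s ω => σ * W s ω) hmeas hcont) (by linarith) hpq
    (by positivity) (hmom.trans_eq ?_)) (ENNReal.mul_lt_top ENNReal.coe_lt_top
      ENNReal.ofReal_lt_top)
  rw [← Real.rpow_mul hT]
  push_cast
  rw [ENNReal.coe_toNNReal hg]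

theorem IsGoodVersion.ae_holderSemi_lt_top [IsProbabilityMeasure P]
    (hW : IsGoodVersion H W P) (σ : ℝ) {β T : ℝ} (hβ : 0 < β) (hβH : β < H) (hT : 0 ≤ T) :
    ∀ᵐ ω ∂P, holderSemi β T (fun s => σ * W s ω) < ∞ := by
  have h := hW.eLpNorm_holderSemi_lt_top σ hβ hβH (p := 1) le_rfl hT
  rw [ENNReal.ofReal_one, eLpNorm_one_eq_lintegral_enorm] at h
  simp only [enorm_eq_self] at h
  refine ae_lt_top (measurable_holderSemi β T (Z := fun s ω => σ * W s ω) (fun s r => ?_)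
    fun ω => (hW.continuous ω).const_mul σ) h.ne
  exact (((hW.measurable s).const_mul σ).sub ((hW.measurable r).const_mul σ)).enorm

end Driver

/-! ### Stability of the flow in Hölder norm -/

section Stability

/-- The Cauchy–Schwarz inequality in `L^p`. -/
theorem eLpNorm_mul_le_eLpNorm_two_mul {Ω : Type*} [MeasurableSpace Ω] {P : Measure Ω}
    {S V : Ω → ℝ≥0∞} (hS : Measurable S) (hV : Measurable V) {p : ℝ} (hp : 0 < p) :
    eLpNorm (fun ω => S ω * V ω) (ENNReal.ofReal p) P
      ≤ eLpNorm S (ENNReal.ofReal (2 * p)) P * eLpNorm V (ENNReal.ofReal (2 * p)) P := by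
  have h2p : 0 < 2 * p := by linarith
  rw [eLpNorm_eq_lintegral_rpow_enorm_toReal (by simpa using hp) ENNReal.ofReal_ne_top,
    eLpNorm_eq_lintegral_rpow_enorm_toReal (by simpa using hp) ENNReal.ofReal_ne_top,
    eLpNorm_eq_lintegral_rpow_enorm_toReal (by simpa using hp) ENNReal.ofReal_ne_top,
    ENNReal.toReal_ofReal hp.le, ENNReal.toReal_ofReal h2p.le]
  simp only [enorm_eq_self]
  have h := ENNReal.lintegral_mul_le_Lp_mul_Lq P Real.HolderConjugate.two_two
    (hS.pow_const p).aemeasurable (hV.pow_const p).aemeasurable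
  simp only [Pi.mul_apply, ← ENNReal.mul_rpow_of_nonneg _ _ hp.le, ← ENNReal.rpow_mul,
    mul_comm p 2] at h
  calc _ ≤ ((∫⁻ ω, S ω ^ (2 * p) ∂P) ^ (1 / (2 : ℝ)) * (∫⁻ ω, V ω ^ (2 * p) ∂P) ^ (1 / (2 : ℝ)))
        ^ (1 / p) := by gcongr
    _ = _ := by
      rw [ENNReal.mul_rpow_of_nonneg _ _ (by positivity), ← ENNReal.rpow_mul, ← ENNReal.rpow_mul]
      congr 2 <;> field_simp

variable {E : Type*} [NormedAddCommGroup E] [NormedSpace ℝ E] {f : E → E} {ψ : ℝ → E → E}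
  {M : NNReal}

theorem enorm_le_holderSemi {β t : ℝ} (hβ : 0 < β) {e : ℝ → ℝ} (he : e 0 = 0) {s : ℝ}
    (hs : s ∈ Icc 0 t) : ‖e s‖ₑ ≤ holderSemi β t e * ENNReal.ofReal (t ^ β) := by
  have h := enorm_sub_le_holderSemi β e hs ⟨le_rfl, hs.1.trans hs.2⟩
  rw [he, sub_zero, sub_zero, abs_of_nonneg hs.1] at h
  refine h.trans ?_
  gcongr
  · exact hs.1
  · exact hs.2

theorem IsFlow.supNormOn_sub_le (hψ : IsFlow f ψ) (hM : ∀ x, ‖f x‖ ≤ M) (z : E) {β t : ℝ}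
    (hβ : 0 < β) (b : ℝ → ℝ) {e : ℝ → ℝ} (he : e 0 = 0) :
    supNormOn t (fun s => ψ (b s + e s) z - ψ (b s) z)
      ≤ M * ENNReal.ofReal (t ^ β) * holderSemi β t e := by
  refine iSup₂_le fun s hs => ?_
  have h1 : ‖ψ (b s + e s) z - ψ (b s) z‖ₑ ≤ M * ‖e s‖ₑ := by
    have h := hψ.norm_sub_le hM (b s + e s) (b s) z
    rw [add_sub_cancel_left] at h
    rw [← ofReal_norm, ← ofReal_norm, ← ENNReal.ofReal_coe_nnreal,
      ← ENNReal.ofReal_mul M.coe_nonneg]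
    exact ENNReal.ofReal_le_ofReal h
  calc _ ≤ M * ‖e s‖ₑ := h1
    _ ≤ M * (holderSemi β t e * ENNReal.ofReal (t ^ β)) := by
        gcongr; exact enorm_le_holderSemi hβ he hs
    _ = _ := by ring

theorem IsFlow.enorm_second_difference_le (hψ : IsFlow f ψ) (hf : IsBoundedField M f) (z : E)
    (b b' e e' : ℝ) :
    ‖(ψ (b + e) z - ψ b z) - (ψ (b' + e') z - ψ b' z)‖ₑ
      ≤ M * ‖e - e'‖ₑ + M ^ 2 * (‖b - b'‖ₑ + ‖e - e'‖ₑ) * ‖e'‖ₑ := by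
  have h := hψ.norm_second_difference_le hf.norm_le hf.lipschitz z b b' e e'
  simp only [← ofReal_norm (b - b'), ← ofReal_norm (e - e'), ← ofReal_norm e',
    ← ENNReal.ofReal_coe_nnreal (p := M)]
  rw [← ENNReal.ofReal_pow M.coe_nonneg, ← ENNReal.ofReal_add (norm_nonneg _) (norm_nonneg _),
    ← ENNReal.ofReal_mul (by positivity), ← ENNReal.ofReal_mul (by positivity),
    ← ENNReal.ofReal_mul (by positivity), ← ENNReal.ofReal_add (by positivity) (by positivity),
    ← ofReal_norm]
  exact ENNReal.ofReal_le_ofReal h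

theorem IsFlow.holderSemi_sub_le (hψ : IsFlow f ψ) (hf : IsBoundedField M f) (z : E) {β t : ℝ}
    (hβ : 0 < β) (b : ℝ → ℝ) {e : ℝ → ℝ} (he : e 0 = 0) :
    holderSemi β t (fun s => ψ (b s + e s) z - ψ (b s) z)
      ≤ (M + M ^ 2 * ENNReal.ofReal (t ^ β) * (holderSemi β t b + holderSemi β t e))
        * holderSemi β t e := by
  refine holderSemi_le fun s hs r hr => (hψ.enorm_second_difference_le hf z _ _ _ _).trans ?_
  have h1 := enorm_sub_le_holderSemi β e hs hr
  have h2 := enorm_sub_le_holderSemi β b hs hr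
  have h3 := enorm_le_holderSemi hβ he hr
  calc _ ≤ M * (holderSemi β t e * ENNReal.ofReal (|s - r| ^ β))
        + M ^ 2 * (holderSemi β t b * ENNReal.ofReal (|s - r| ^ β)
          + holderSemi β t e * ENNReal.ofReal (|s - r| ^ β))
          * (holderSemi β t e * ENNReal.ofReal (t ^ β)) := by gcongr
    _ = _ := by ring

/-- The solution map of the scalar-driven equation is locally Lipschitz in the driver, in Hölder
norm; the local Lipschitz constant grows linearly in the Hölder seminorms of the drivers. -/
theorem IsFlow.holderNormOn_sub_le (hψ : IsFlow f ψ) (hf : IsBoundedField M f) (z : E)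
    {β t T : ℝ} (hβ : 0 < β) (ht : 0 ≤ t) (htT : t ≤ T) (b : ℝ → ℝ) {e : ℝ → ℝ} (he : e 0 = 0) :
    holderNormOn β t (fun s => ψ (b s + e s) z - ψ (b s) z)
      ≤ holderSemi β t e * ((M * ENNReal.ofReal (T ^ β) + M)
        + M ^ 2 * ENNReal.ofReal (T ^ β) * (holderSemi β T b + holderSemi β t e)) := by
  have hp : ENNReal.ofReal (t ^ β) ≤ ENNReal.ofReal (T ^ β) := by gcongr
  rw [holderNormOn_eq]
  calc _ ≤ M * ENNReal.ofReal (t ^ β) * holderSemi β t e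
        + (M + M ^ 2 * ENNReal.ofReal (t ^ β) * (holderSemi β t b + holderSemi β t e))
          * holderSemi β t e := add_le_add (hψ.supNormOn_sub_le hf.norm_le z hβ b he)
            (hψ.holderSemi_sub_le hf z hβ b he)
    _ ≤ M * ENNReal.ofReal (T ^ β) * holderSemi β t e
        + (M + M ^ 2 * ENNReal.ofReal (T ^ β) * (holderSemi β T b + holderSemi β t e))
          * holderSemi β t e := by
        gcongr
        exact holderSemi_mono b htT
    _ = _ := by ring

theorem IsFlow.holderNormOn_lt_top (hψ : IsFlow f ψ) (hM : ∀ x, ‖f x‖ ≤ M) (z : E) {β T : ℝ}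
    (hβ : 0 < β) {b : ℝ → ℝ} (hb : b 0 = 0) (h : holderSemi β T b < ∞) :
    holderNormOn β T (fun s => ψ (b s) z) < ∞ := by
  have hlip : ∀ a a', ‖ψ a z - ψ a' z‖ₑ ≤ M * ‖a - a'‖ₑ := fun a a' => by
    rw [← ofReal_norm, ← ofReal_norm, ← ENNReal.ofReal_coe_nnreal,
      ← ENNReal.ofReal_mul M.coe_nonneg]
    exact ENNReal.ofReal_le_ofReal (hψ.norm_sub_le hM a a' z)
  refine ENNReal.add_lt_top.2 ⟨?_, ?_⟩
  · refine lt_of_le_of_lt (b := ‖z‖ₑ + M * (holderSemi β T b * ENNReal.ofReal (T ^ β)))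
      (iSup₂_le fun s hs => ?_) ?_
    · have h1 := hlip (b s) 0
      rw [hψ.zero, sub_zero] at h1
      calc ‖ψ (b s) z‖ₑ = ‖z + (ψ (b s) z - z)‖ₑ := by rw [add_sub_cancel]
        _ ≤ ‖z‖ₑ + ‖ψ (b s) z - z‖ₑ := enorm_add_le _ _
        _ ≤ _ := by
          gcongr
          refine h1.trans ?_
          gcongr
          exact enorm_le_holderSemi hβ hb hs
    · have := h.ne
      finiteness
  · refine lt_of_le_of_lt (b := M * holderSemi β T b) (holderSemi_le fun s hs r hr => ?_)
      (ENNReal.mul_lt_top ENNReal.coe_lt_top h)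
    refine (hlip _ _).trans ?_
    rw [mul_assoc]
    gcongr
    exact enorm_sub_le_holderSemi β b hs hr

end Stability

/-! ### Rates of convergence in `L^p` -/

section Rates

variable {Ω : Type*} [MeasurableSpace Ω] {P : Measure Ω} {H : ℝ}
  {W : ℝ → Ω → ℝ} {E : Type*} [NormedAddCommGroup E] [NormedSpace ℝ E]
  {f : E → E} {ψ : ℝ → E → E} {M : NNReal}

/-- The difference between the solutions of the slow and of the limiting equation, both written
in terms of the flow `ψ` of the vector field. -/
noncomputable def solutionError (ψ : ℝ → E → E) (σ ε : ℝ) (x₀ : E) (b : ℝ → ℝ) (s : ℝ) : E :=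
  ψ (σ * b s + driverError σ ε b s) x₀ - ψ (σ * b s) x₀

theorem IsGoodVersion.continuous_solutionError (hW : IsGoodVersion H W P) (hψ : IsFlow f ψ)
    (σ : ℝ) {ε : ℝ} (hε : 0 < ε) (x₀ : E) (ω : Ω) :
    Continuous fun s => solutionError ψ σ ε x₀ (fun r => W r ω) s := by
  have h1 := (hW.continuous ω).const_mul σ
  exact ((hψ.continuous x₀).comp (h1.add (hW.continuous_driverError σ hε ω))).sub
    ((hψ.continuous x₀).comp h1)

theorem IsGoodVersion.measurable_solutionError [MeasurableSpace E] [BorelSpace E]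
    [SecondCountableTopology E] (hW : IsGoodVersion H W P) (hψ : IsFlow f ψ)
    (σ : ℝ) {ε : ℝ} (hε : 0 < ε) (x₀ : E) (s : ℝ) :
    Measurable fun ω => solutionError ψ σ ε x₀ (fun r => W r ω) s := by
  have h1 := (hW.measurable s).const_mul σ
  exact ((hψ.continuous x₀).measurable.comp (h1.add (hW.measurable_driverError σ hε s))).sub
    ((hψ.continuous x₀).measurable.comp h1)

theorem IsGoodVersion.measurable_holderNormOn_solutionError [MeasurableSpace E] [BorelSpace E]
    [SecondCountableTopology E] (hW : IsGoodVersion H W P) (hψ : IsFlow f ψ)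
    (σ : ℝ) {ε : ℝ} (hε : 0 < ε) (x₀ : E) (β t : ℝ) :
    Measurable fun ω => holderNormOn β t (solutionError ψ σ ε x₀ fun r => W r ω) := by
  have hm := hW.measurable_solutionError hψ σ hε x₀
  have hc := hW.continuous_solutionError hψ σ hε x₀
  exact (measurable_supNormOn t (fun s => (hm s).enorm) hc).add
    (measurable_holderSemi β t (fun s r => ((hm s).sub (hm r)).enorm) hc)

/-- The rate in Hölder norm. The last factor comes from the random local Lipschitz constant of the
solution map, separated from the driver error by the Cauchy–Schwarz inequality. -/
theorem IsGoodVersion.eLpNorm_holderNormOn_solutionError_le [IsProbabilityMeasure P]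
    (hW : IsGoodVersion H W P) (hψ : IsFlow f ψ) (hf : IsBoundedField M f) (σ : ℝ) (x₀ : E)
    {γ γ' p T : ℝ} (hγ' : 0 < γ')
    (hγ : γ' < γ) (hγH : γ < H) (hp : 1 ≤ p) (hT : 0 ≤ T) :
    ∃ K L : NNReal, ∀ ε > 0, ∀ t ∈ Icc 0 T,
      eLpNorm (fun ω => holderNormOn γ' t (solutionError ψ σ ε x₀ fun r => W r ω))
        (ENNReal.ofReal p) P
        ≤ ENNReal.ofReal (t ^ (γ - γ') * ε ^ (H - γ))
          * (K + L * ENNReal.ofReal (ε ^ (H - γ))) := by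
  have h2p : 1 ≤ 2 * p := by linarith
  have h2p' : 1 ≤ ENNReal.ofReal (2 * p) := ENNReal.one_le_ofReal.2 h2p
  obtain ⟨C, hC⟩ := hW.eLpNorm_holderSemi_driverError_le σ hγ' hγ hγH h2p
  have hN := hW.eLpNorm_holderSemi_lt_top σ hγ' (hγ.trans hγH) h2p hT
  set n := eLpNorm (fun ω => holderSemi γ' T fun s => σ * W s ω) (ENNReal.ofReal (2 * p)) P
    with hn
  set D : NNReal := M ^ 2 * Real.toNNReal (T ^ γ') with hD
  set A : NNReal := M * Real.toNNReal (T ^ γ') + M with hA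
  refine ⟨C * (A + D * n.toNNReal), C * (D * (C * Real.toNNReal (T ^ (γ - γ')))),
    fun ε hε t ht => ?_⟩
  have hmS : Measurable fun ω => holderSemi γ' t (driverError σ ε fun s => W s ω) :=
    measurable_holderSemi γ' t (Z := fun s ω => driverError σ ε (fun s => W s ω) s)
      (fun s r => ((hW.measurable_driverError σ hε s).sub
        (hW.measurable_driverError σ hε r)).enorm) (hW.continuous_driverError σ hε)
  have hmN : Measurable fun ω => holderSemi γ' T fun s => σ * W s ω :=
    measurable_holderSemi γ' T (Z := fun s ω => σ * W s ω)
      (fun s r => (((hW.measurable s).const_mul σ).sub ((hW.measurable r).const_mul σ)).enorm)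
      fun ω => (hW.continuous ω).const_mul σ
  set S : Ω → ℝ≥0∞ := fun ω => holderSemi γ' t (driverError σ ε fun s => W s ω) with hS
  set N : Ω → ℝ≥0∞ := fun ω => holderSemi γ' T fun s => σ * W s ω with hNdef
  have hpt : ∀ ω, holderNormOn γ' t (solutionError ψ σ ε x₀ fun r => W r ω)
      ≤ S ω * (A + D * (N ω + S ω)) := fun ω => by
    refine (hψ.holderNormOn_sub_le hf x₀ hγ' ht.1 ht.2 (fun s => σ * W s ω)
      (driverError_zero (hW.zero ω))).trans_eq ?_
    simp only [hA, hD]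
    push_cast
    rfl
  have hr : eLpNorm S (ENNReal.ofReal (2 * p)) P
      ≤ C * ENNReal.ofReal (t ^ (γ - γ') * ε ^ (H - γ)) := hC ε hε t ht.1
  have hrT : ENNReal.ofReal (t ^ (γ - γ') * ε ^ (H - γ))
      ≤ Real.toNNReal (T ^ (γ - γ')) * ENNReal.ofReal (ε ^ (H - γ)) := by
    have h0 : 0 ≤ t ^ (γ - γ') := Real.rpow_nonneg ht.1 _
    rw [ENNReal.ofReal_mul h0]
    gcongr
    exact ENNReal.ofReal_le_ofReal (Real.rpow_le_rpow ht.1 ht.2 (by linarith))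
  have hV : eLpNorm (fun ω => A + D * (N ω + S ω)) (ENNReal.ofReal (2 * p)) P
      ≤ A + D * (n + C * (Real.toNNReal (T ^ (γ - γ')) * ENNReal.ofReal (ε ^ (H - γ)))) := by
    have hsum : Measurable fun ω => N ω + S ω := hmN.add hmS
    have h1 : eLpNorm (fun _ : Ω => (A : ℝ≥0∞)) (ENNReal.ofReal (2 * p)) P ≤ A := by
      rw [eLpNorm_const _ (by positivity) (IsProbabilityMeasure.ne_zero P)]
      simp
    have h2 : eLpNorm (fun ω => D * (N ω + S ω)) (ENNReal.ofReal (2 * p)) P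
        ≤ D * eLpNorm (fun ω => N ω + S ω) (ENNReal.ofReal (2 * p)) P := by
      have := eLpNorm_le_nnreal_smul_eLpNorm_of_ae_le_mul' (c := D) (μ := P)
        (f := fun ω => (D : ℝ≥0∞) * (N ω + S ω)) (g := fun ω => N ω + S ω)
        (ae_of_all _ fun ω => le_rfl) (ENNReal.ofReal (2 * p))
      simpa [ENNReal.smul_def] using this
    have h3 : eLpNorm (fun ω => N ω + S ω) (ENNReal.ofReal (2 * p)) P
        ≤ n + eLpNorm S (ENNReal.ofReal (2 * p)) P :=
      eLpNorm_add_le hmN.aestronglyMeasurable hmS.aestronglyMeasurable h2p'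
    refine (eLpNorm_add_le aestronglyMeasurable_const
      (hsum.const_mul _).aestronglyMeasurable h2p').trans ?_
    gcongr
    refine h2.trans ?_
    gcongr
    refine h3.trans ?_
    gcongr
    exact hr.trans (by gcongr)
  calc _ ≤ eLpNorm (fun ω => S ω * (A + D * (N ω + S ω))) (ENNReal.ofReal p) P :=
        eLpNorm_mono_enorm fun ω => by simpa using hpt ω
    _ ≤ _ := eLpNorm_mul_le_eLpNorm_two_mul hmS
        (measurable_const.add ((hmN.add hmS).const_mul _)) (by linarith)
    _ ≤ C * ENNReal.ofReal (t ^ (γ - γ') * ε ^ (H - γ)) * (A + D * (n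
          + C * (Real.toNNReal (T ^ (γ - γ')) * ENNReal.ofReal (ε ^ (H - γ))))) := by
        gcongr
        exact hV
    _ = _ := by
        push_cast
        rw [ENNReal.coe_toNNReal hN.ne]
        ring

theorem IsGoodVersion.eLpNorm_supNormOn_solutionError_le [IsProbabilityMeasure P]
    (hW : IsGoodVersion H W P) (hψ : IsFlow f ψ) (hf : IsBoundedField M f) (σ : ℝ) (x₀ : E)
    {γ γ' p : ℝ} (hγ' : 0 < γ')
    (hγ : γ' < γ) (hγH : γ < H) (hp : 1 ≤ p) :
    ∃ K : NNReal, ∀ ε > 0, ∀ t, 0 ≤ t →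
      eLpNorm (fun ω => supNormOn t (solutionError ψ σ ε x₀ fun r => W r ω)) (ENNReal.ofReal p) P
        ≤ ENNReal.ofReal (K * t ^ γ * ε ^ (H - γ)) := by
  obtain ⟨C, hC⟩ := hW.eLpNorm_holderSemi_driverError_le σ hγ' hγ hγH hp
  refine ⟨M * C, fun ε hε t ht => ?_⟩
  have h := eLpNorm_le_nnreal_smul_eLpNorm_of_ae_le_mul' (c := M * Real.toNNReal (t ^ γ')) (μ := P)
    (f := fun ω => supNormOn t (solutionError ψ σ ε x₀ fun r => W r ω))
    (g := fun ω => holderSemi γ' t (driverError σ ε fun s => W s ω))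
    (ae_of_all _ fun ω => by
      have := hψ.supNormOn_sub_le hf.norm_le x₀ (t := t) hγ' (fun s => σ * W s ω)
        (driverError_zero (σ := σ) (ε := ε) (b := fun s => W s ω) (hW.zero ω))
      rw [enorm_eq_self, enorm_eq_self, ENNReal.coe_mul]
      exact this) (ENNReal.ofReal p)
  have ht1 : t ^ γ = t ^ γ' * t ^ (γ - γ') := by
    rw [← Real.rpow_add_of_nonneg ht hγ'.le (by linarith), add_sub_cancel]
  have hC' := hC ε hε t ht
  calc _ ≤ _ := h
    _ = M * ENNReal.ofReal (t ^ γ') * eLpNorm (fun ω => holderSemi γ' t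
          (driverError σ ε fun s => W s ω)) (ENNReal.ofReal p) P := by
        rw [ENNReal.smul_def, smul_eq_mul, ENNReal.coe_mul]; rfl
    _ ≤ M * ENNReal.ofReal (t ^ γ') * (C * ENNReal.ofReal (t ^ (γ - γ') * ε ^ (H - γ))) := by
        gcongr
    _ = _ := by
        rw [← ENNReal.ofReal_coe_nnreal, ← ENNReal.ofReal_coe_nnreal (p := C),
          ← ENNReal.ofReal_mul (by positivity), ← ENNReal.ofReal_mul (by positivity),
          ← ENNReal.ofReal_mul (by positivity), ht1]
        push_cast
        congr 1
        ring

end Rates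

/-! ### The slow equation and the limit theorem -/

/-- The driver `σ A` of the slow equation, `A` being the exponential moving average of `b`, has
derivative `ε ^ (H - 1) y`, so the slow equation is solved by the flow evaluated along it. -/
theorem IsFlow.isSlowSolution_and_eqOn {E : Type*} [NormedAddCommGroup E] [NormedSpace ℝ E]
    {f : E → E} {ψ : ℝ → E → E} {M : NNReal} (hψ : IsFlow f ψ) (hL : LipschitzWith M f)
    {b : ℝ → ℝ} (hg : IsSubexpAtBot b) (hb : Continuous b) {ε : ℝ} (hε : 0 < ε) (H σ T : ℝ)
    (x₀ : E) :
    IsSlowSolution H ε T f x₀ (fun t => σ / ε ^ H * (b t - expAverage ε b t))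
        (fun t => ψ (σ * b t + driverError σ ε b t) x₀) ∧
      ∀ z, IsSlowSolution H ε T f x₀ (fun t => σ / ε ^ H * (b t - expAverage ε b t)) z →
        EqOn z (fun t => ψ (σ * b t + driverError σ ε b t) x₀) (Icc 0 T) := by
  have hX : ∀ t, HasDerivAt (fun t => σ * expAverage ε b t)
      (ε ^ (H - 1) * (σ / ε ^ H * (b t - expAverage ε b t))) t := fun t => by
    refine ((hasDerivAt_expAverage hg hb hε t).const_mul σ).congr_deriv ?_
    have hεH : 0 < ε ^ H := Real.rpow_pos_of_pos hε H
    rw [Real.rpow_sub_one hε.ne']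
    field_simp
  have hdrv : ∀ t, σ * b t + driverError σ ε b t
      = σ * expAverage ε b t - σ * expAverage ε b 0 := fun t => by
    rw [driverError]; ring
  simp only [hdrv]
  refine ⟨⟨by simp [hψ.zero], fun t _ => ?_⟩, fun z hz => ?_⟩
  · exact (HasDerivAt.scomp t (hψ.hasDerivAt x₀ _)
      ((hX t).sub_const (σ * expAverage ε b 0))).hasDerivWithinAt
  · have hc : Continuous fun t => ε ^ (H - 1) * (σ / ε ^ H * (b t - expAverage ε b t)) :=
      ((hb.sub (continuous_expAverage hg hb hε)).const_mul _).const_mul _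
    exact hψ.eqOn_of_hasDerivWithinAt hL hX hc hz.1 hz.2

theorem mainTheorem5 {Ω : Type*} [MeasurableSpace Ω] (P : Measure Ω) [IsProbabilityMeasure P]
    (H : ℝ) (hH : 1 / 3 < H) (hH1 : H < 1)
    (B : ℝ → Ω → ℝ) (hB : IsFractionalBrownianMotion H B P) (σ : ℝ)
    (d : ℕ) (f : EuclideanSpace ℝ (Fin d) → EuclideanSpace ℝ (Fin d)) (hf : IsCb3 f)
    (x₀ : EuclideanSpace ℝ (Fin d)) (T : ℝ) (hT : 0 < T) :
    ∃ (y : ℝ → ℝ → Ω → ℝ) (xε : ℝ → ℝ → Ω → EuclideanSpace ℝ (Fin d))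
      (x : ℝ → Ω → EuclideanSpace ℝ (Fin d)),
      -- the fast process, and the slow equation with its unique solution
      (∀ᵐ ω ∂P, ∀ ε > 0,
        IsFastFOU H σ ε (fun t => B t ω) (fun t => y ε t ω) ∧
        IsSlowSolution H ε T f x₀ (fun t => y ε t ω) (fun t => xε ε t ω) ∧
        ∀ z, IsSlowSolution H ε T f x₀ (fun t => y ε t ω) z →
          EqOn z (fun t => xε ε t ω) (Icc 0 T)) ∧
      -- the limiting rough differential equation with its unique solution
      (∀ᵐ ω ∂P,
        IsRDESolution T f x₀ (fun t => σ * B t ω) (geometricLift fun t => σ * B t ω)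
          (fun t => x t ω) ∧
        ∀ z, IsRDESolution T f x₀ (fun t => σ * B t ω) (geometricLift fun t => σ * B t ω) z →
          EqOn z (fun t => x t ω) (Icc 0 T)) ∧
      -- in the Young regime it is the Young differential equation
      (1 / 2 < H → ∀ᵐ ω ∂P,
        IsYoungSolution T f x₀ (fun t => σ * B t ω) (fun t => x t ω) ∧
        ∀ z, IsYoungSolution T f x₀ (fun t => σ * B t ω) z →
          EqOn z (fun t => x t ω) (Icc 0 T)) ∧
      ∀ γ γ' p : ℝ, 0 < γ' → γ' < γ → γ < H → 1 ≤ p →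
        -- the distances are `L^p` random variables, and `x` has paths in `C^{γ'}([0, T])`
        (∀ᵐ ω ∂P, holderNormOn γ' T (fun s => x s ω) < ∞) ∧
        (∀ ε > 0, ∀ t ∈ Icc 0 T,
          MemLp (fun ω => holderNormOn γ' t (fun s => xε ε s ω - x s ω)) (ENNReal.ofReal p) P) ∧
        -- convergence in `L^p` in `C^{γ'}([0, T])`
        Tendsto (fun ε => eLpNorm (fun ω => holderNormOn γ' T (fun s => xε ε s ω - x s ω))
          (ENNReal.ofReal p) P) (𝓝[>] 0) (𝓝 0) ∧
        -- rate in `C^{γ'}([0, t])`, uniformly in `t` and `ε`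
        (∃ C : ℝ, ∀ t ∈ Icc 0 T, ∀ ε ∈ Ioc (0 : ℝ) 1,
          eLpNorm (fun ω => holderNormOn γ' t (fun s => xε ε s ω - x s ω)) (ENNReal.ofReal p) P
            ≤ ENNReal.ofReal (C * t ^ (γ - γ') * ε ^ (H - γ))) ∧
        -- hence the rate `t^γ ε^(H-γ)` in `C^{γ'}([0, t])`, uniformly for `t` away from `0`
        (∀ δ > 0, ∃ C : ℝ, ∀ t ∈ Icc δ T, ∀ ε ∈ Ioc (0 : ℝ) 1,
          eLpNorm (fun ω => holderNormOn γ' t (fun s => xε ε s ω - x s ω)) (ENNReal.ofReal p) P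
            ≤ ENNReal.ofReal (C * t ^ γ * ε ^ (H - γ))) ∧
        -- and the rate `t^γ ε^(H-γ)` for the supremum norm on `[0, t]`, uniformly in `t` and `ε`
        (∃ C : ℝ, ∀ t ∈ Icc 0 T, ∀ ε ∈ Ioc (0 : ℝ) 1,
          eLpNorm (fun ω => supNormOn t (fun s => xε ε s ω - x s ω)) (ENNReal.ofReal p) P
            ≤ ENNReal.ofReal (C * t ^ γ * ε ^ (H - γ))) := by
  obtain ⟨M, hf⟩ := hf.exists_isBoundedField
  obtain ⟨ψ, hψ⟩ := hf.exists_isFlow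
  obtain ⟨W, hWB, hW⟩ := hB.exists_isGoodVersion (by linarith) hH1
  have hWB' : ∀ᵐ ω ∂P, (fun t => B t ω) = fun t => W t ω :=
    hWB.mono fun ω h => funext fun t => (h t).symm
  have hW0 : ∀ ω, σ * W 0 ω = 0 := fun ω => by rw [hW.zero, mul_zero]
  refine ⟨fun ε t ω => σ / ε ^ H * (W t ω - expAverage ε (fun s => W s ω) t),
    fun ε t ω => ψ (σ * W t ω + driverError σ ε (fun s => W s ω) t) x₀,
    fun t ω => ψ (σ * W t ω) x₀, ?_, ?_, ?_, ?_⟩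
  · filter_upwards [hWB'] with ω hω ε hε
    rw [hω]
    exact ⟨isFastFOU_sub_expAverage (hW.subexp ω) (hW.continuous ω) hε H σ,
      hψ.isSlowSolution_and_eqOn hf.lipschitz (hW.subexp ω) (hW.continuous ω) hε H σ T x₀⟩
  · -- Any Hölder exponent in `(1/3, min (1/2) H)` will do.
    obtain ⟨β, hβ, hβm⟩ := exists_between (lt_min (show (1 / 3 : ℝ) < 1 / 2 by norm_num) hH)
    filter_upwards [hWB', hW.ae_holderSemi_lt_top σ (show 0 < β by linarith)
      (hβm.trans_le (min_le_right _ _)) hT.le] with ω hω hfin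
    have hBW : (fun t => σ * B t ω) = fun t => σ * W t ω := by
      funext t; rw [show B t ω = W t ω from congrFun hω t]
    rw [hBW]
    refine ⟨hψ.isRDESolution hf hβ (hβm.trans_le (min_le_left _ _)).le
      (isHolderPath_of_holderSemi_lt_top hfin) (hW0 ω), fun z hz t ht => ?_⟩
    have := hψ.eqOn_of_isRDESolution hf hz ht
    simpa only [hW0, sub_zero] using this
  · intro hH2
    obtain ⟨β, hβ, hβH⟩ := exists_between hH2
    filter_upwards [hWB', hW.ae_holderSemi_lt_top σ (show 0 < β by linarith) hβH hT.le]
      with ω hω hfin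
    have hBW : (fun t => σ * B t ω) = fun t => σ * W t ω := by
      funext t; rw [show B t ω = W t ω from congrFun hω t]
    rw [hBW]
    refine ⟨hψ.isYoungSolution hf hβ (hβH.trans hH1)
      (isHolderPath_of_holderSemi_lt_top hfin) (hW0 ω), fun z hz t ht => ?_⟩
    have := hψ.eqOn_of_isYoungSolution hf hz ht
    simpa only [hW0, sub_zero] using this
  · intro γ γ' p hγ' hγ hγH hp
    obtain ⟨K, L, hKL⟩ := hW.eLpNorm_holderNormOn_solutionError_le hψ hf σ x₀ hγ' hγ hγH hp hT.le
    obtain ⟨K', hK'⟩ := hW.eLpNorm_supNormOn_solutionError_le hψ hf σ x₀ hγ' hγ hγH hp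
    have hrate : ∀ t ∈ Icc 0 T, ∀ ε ∈ Ioc (0 : ℝ) 1,
        eLpNorm (fun ω => holderNormOn γ' t (solutionError ψ σ ε x₀ fun r => W r ω))
          (ENNReal.ofReal p) P ≤ ENNReal.ofReal ((K + L) * t ^ (γ - γ') * ε ^ (H - γ)) := by
      intro t ht ε hε
      have hε1 : ε ^ (H - γ) ≤ 1 := Real.rpow_le_one hε.1.le hε.2 (by linarith)
      refine (hKL ε hε.1 t ht).trans ?_
      calc _ ≤ ENNReal.ofReal (t ^ (γ - γ') * ε ^ (H - γ)) * (K + L * ENNReal.ofReal 1) := by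
            gcongr
        _ = _ := by
            have h0 : 0 ≤ t ^ (γ - γ') * ε ^ (H - γ) :=
              mul_nonneg (Real.rpow_nonneg ht.1 _) (Real.rpow_nonneg hε.1.le _)
            rw [ENNReal.ofReal_one, mul_one, ← ENNReal.coe_add, ← ENNReal.ofReal_coe_nnreal,
              ← ENNReal.ofReal_mul h0, NNReal.coe_add]
            congr 1
            ring
    refine ⟨?_, fun ε hε t ht => ?_, ?_, ⟨K + L, hrate⟩, fun δ hδ => ?_,
      ⟨K', fun t ht ε hε => hK' ε hε.1 t ht.1⟩⟩
    · filter_upwards [hW.ae_holderSemi_lt_top σ hγ' (hγ.trans hγH) hT.le] with ω hfin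
      exact hψ.holderNormOn_lt_top hf.norm_le x₀ hγ' (hW0 ω) hfin
    · refine ⟨(hW.measurable_holderNormOn_solutionError hψ σ hε x₀ γ' t).aestronglyMeasurable,
        (hKL ε hε t ht).trans_lt ?_⟩
      finiteness
    · have hlim : Tendsto (fun ε : ℝ => ENNReal.ofReal ((K + L) * T ^ (γ - γ') * ε ^ (H - γ)))
          (𝓝[>] 0) (𝓝 0) := by
        have h1 : Tendsto (fun ε : ℝ => (K + L) * T ^ (γ - γ') * ε ^ (H - γ)) (𝓝 0) (𝓝 0) := by
          have h2 := ((Real.continuous_rpow_const (q := H - γ) (by linarith)).tendsto 0).const_mul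
            ((K + L) * T ^ (γ - γ'))
          rwa [Real.zero_rpow (by linarith), mul_zero] at h2
        simpa using ENNReal.tendsto_ofReal (h1.mono_left nhdsWithin_le_nhds)
      refine tendsto_of_tendsto_of_tendsto_of_le_of_le' tendsto_const_nhds hlim
        (Eventually.of_forall fun _ => zero_le) ?_
      filter_upwards [Ioc_mem_nhdsGT (zero_lt_one' ℝ)] with ε hε
      exact hrate T ⟨hT.le, le_rfl⟩ ε hε
    · -- On `[δ, T]` the factor `t ^ (-γ')` lost in the Hölder rate is at most `δ ^ (-γ')`.
      refine ⟨(K + L) * δ ^ (-γ'), fun t ht ε hε => ?_⟩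
      have ht0 : 0 < t := hδ.trans_le ht.1
      refine (hrate t ⟨ht0.le, ht.2⟩ ε hε).trans (ENNReal.ofReal_le_ofReal ?_)
      have h1 : t ^ (γ - γ') ≤ δ ^ (-γ') * t ^ γ := by
        rw [sub_eq_neg_add, Real.rpow_add ht0]
        gcongr ?_ * _
        exact Real.rpow_le_rpow_of_nonpos hδ ht.1 (by linarith)
      have h2 : 0 ≤ ε ^ (H - γ) := Real.rpow_nonneg hε.1.le _
      calc _ ≤ (K + L : ℝ) * (δ ^ (-γ') * t ^ γ) * ε ^ (H - γ) := by gcongr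
        _ = _ := by ring
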